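/- Let $d\ge 0$ be an integer. The Heisenberg group $\mathbf H=\mathbf H(d)$ is $\mathbb{R}^d\times\mathbb{R}^d\times\mathbb{R}$ with the product topology and the multiplication $$(x,\omega,\tau)\bullet(x',\omega',\tau')=\bigl(x+x',\;\omega+\omega',\;\tau+\tau'+\tfrac12(x'\cdot\omega-x\cdot\omega')\bigr).$$ A unitary representation $(\mathcal H,\pi)$ of $\mathbf H$ is a strongly continuous homomorphism $\pi$ from $\mathbf H$ into the group of unitary operators of a complex Hilbert space $\mathcal H$. It is irreducible if $\mathcal H\neq\{0\}$ and $\{0\}$ and $\mathcal H$ are the only closed subspaces of $\mathcal H$ that are invariant under all $\pi(\mathbf h)$, $\mathbf h\in\mathbf H$. Two unitary representations $(\mathcal H_1,\pi_1)$ and $(\mathcal H_2,\pi_2)$ are equivalent if there is a unitary operator $U:\mathcal H_1\to\mathcal H_2$ with $U\pi_1(\mathbf h)U^{-1}=\pi_2(\mathbf h)$ for all $\mathbf h\in\mathbf H$. On $L^2(\mathbb{R}^d)$ put $T_xf(t)=f(t-x)$ and $M_\omega f(t)=e^{2\pi i\omega\cdot t}f(t)$. The Schrödinger representation is $\rho(x,\omega,\tau)=e^{2\pi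 i\tau}M_{\omega/2}T_xM_{\omega/2}$, and $\rho_\kappa(x,\omega,\tau)=\rho(\kappa x,\omega,\kappa\tau)$ for $\kappa\in\mathbb{R}\setminus\{0\}$. **Theorem (Stone–von Neumann).** 1. Every irreducible unitary representation of $\mathbf H$ is equivalent to exactly one of the following representations: (i) $\chi_{a,b}(x,\omega,\tau)=e^{2\pi i(a\cdot x+b\cdot\omega)}$ acting on $\mathbb{C}$, for some $(a,b)\in\mathbb{R}^{2d}$; (ii) $\rho_\kappa$ acting on $L^2(\mathbb{R}^d)$, for some $\kappa\in\mathbb{R}\setminus\{0\}$. That is, either it is equivalent to $\chi_{a,b}$ for a unique $(a,b)$ and to no $\rho_\kappa$, or it is equivalent to $\rho_\kappa$ for a unique $\kappa\ne0$ and to no $\chi_{a,b}$. 2. If $(\mathcal H,\pi)$ is a unitary representation of $\mathbf H$, not necessarily irreducible, with $\pi(x,\omega,\tau)=e^{2\pi i\tau}\pi(x,\omega,0)$ for all $(x,\omega,\tau)\in\mathbf H$, then $\pi$ is a (finite or infinite, possibly empty) Hilbert space direct sum of representations equivalent to $\rho$: $\mathcal H$ is the orthogonal Hilbert sum of closed invariant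 subspaces on each of which $\pi$ restricts to a representation equivalent to $\rho$. -/

import Mathlib

open MeasureTheory

noncomputable section

/-! ### The Heisenberg group -/

/-- The full Heisenberg group `ℝ^d × ℝ^d × ℝ`, with elements `(x, ω, τ)`. -/
@[ext]
structure Heisenberg (d : ℕ) where
  x : EuclideanSpace ℝ (Fin d)
  ω : EuclideanSpace ℝ (Fin d)
  τ : ℝ

namespace Heisenberg

variable {d : ℕ}

/-- `(x,ω,τ) • (x',ω',τ') = (x + x', ω + ω', τ + τ' + (x' ⬝ ω - x ⬝ ω') / 2)`. -/
instance : Mul (Heisenberg d) where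
  mul h k := ⟨h.x + k.x, h.ω + k.ω,
    h.τ + k.τ + (1 / 2 : ℝ) * (inner ℝ k.x h.ω - inner ℝ h.x k.ω)⟩

instance : One (Heisenberg d) where
  one := ⟨0, 0, 0⟩

instance : Inv (Heisenberg d) where
  inv h := ⟨-h.x, -h.ω, -h.τ⟩

@[simp] theorem mul_x (h k : Heisenberg d) : (h * k).x = h.x + k.x := rfl
@[simp] theorem mul_ω (h k : Heisenberg d) : (h * k).ω = h.ω + k.ω := rfl
@[simp] theorem mul_τ (h k : Heisenberg d) :
    (h * k).τ = h.τ + k.τ + (1 / 2 : ℝ) * (inner ℝ k.x h.ω - inner ℝ h.x k.ω) := rfl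
@[simp] theorem one_x : (1 : Heisenberg d).x = 0 := rfl
@[simp] theorem one_ω : (1 : Heisenberg d).ω = 0 := rfl
@[simp] theorem one_τ : (1 : Heisenberg d).τ = 0 := rfl
@[simp] theorem inv_x (h : Heisenberg d) : h⁻¹.x = -h.x := rfl
@[simp] theorem inv_ω (h : Heisenberg d) : h⁻¹.ω = -h.ω := rfl
@[simp] theorem inv_τ (h : Heisenberg d) : h⁻¹.τ = -h.τ := rfl

instance : Group (Heisenberg d) :=
  Group.ofLeftAxioms
    (fun a b c => by
      ext1
      · simp [add_assoc]
      · simp [add_assoc]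
      · simp only [mul_x, mul_ω, mul_τ, inner_add_left, inner_add_right]; ring)
    (fun a => by ext1 <;> simp)
    (fun a => by ext1 <;> simp)

/-- The product topology of `ℝ^d × ℝ^d × ℝ`. -/
instance : TopologicalSpace (Heisenberg d) :=
  TopologicalSpace.induced (fun h => (h.x, h.ω, h.τ)) inferInstance

theorem continuous_coords :
    Continuous (fun h : Heisenberg d => (h.x, h.ω, h.τ)) := continuous_induced_dom

theorem continuous_x : Continuous (fun h : Heisenberg d => h.x) := continuous_coords.fst

theorem continuous_ω : Continuous (fun h : Heisenberg d => h.ω) := continuous_coords.snd.fst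

theorem continuous_τ : Continuous (fun h : Heisenberg d => h.τ) := continuous_coords.snd.snd

/-- The dilation `δ_κ (x, ω, τ) = (κ x, ω, κ τ)`. -/
def dilation (κ : ℝ) : Heisenberg d →* Heisenberg d where
  toFun h := ⟨κ • h.x, h.ω, κ * h.τ⟩
  map_one' := by ext1 <;> simp
  map_mul' h k := by
    ext1
    · simp
    · simp
    · simp only [mul_τ, real_inner_smul_left]; ring

theorem continuous_dilation (κ : ℝ) : Continuous (dilation (d := d) κ) :=
  continuous_induced_rng.2
    ((continuous_x.const_smul κ).prodMk (continuous_ω.prodMk (continuous_τ.const_mul κ)))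

end Heisenberg

/-! ### Unitary representations -/

/-- A unitary representation of a topological group `G` on a complex Hilbert space `H`: a strongly
continuous homomorphism from `G` to the group of unitary operators (surjective linear isometries)
of `H`. (Completeness of `H` is assumed where the definition is used.) -/
structure UnitaryRep (G : Type*) [Group G] [TopologicalSpace G]
    (H : Type*) [NormedAddCommGroup H] [InnerProductSpace ℂ H] where
  toHom : G →* (H ≃ₗᵢ[ℂ] H)
  strongly_continuous : ∀ v : H, Continuous fun g => toHom g v

namespace UnitaryRep

variable {G : Type*} [Group G] [TopologicalSpace G]
variable {H : Type*} [NormedAddCommGroup H] [InnerProductSpace ℂ H]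
variable {H' : Type*} [NormedAddCommGroup H'] [InnerProductSpace ℂ H']

instance : CoeFun (UnitaryRep G H) (fun _ => G → (H ≃ₗᵢ[ℂ] H)) where
  coe π := π.toHom

/-- A multiplicative, unital, strongly continuous family of linear isometries indexed by a group
consists of unitary operators and is a unitary representation. -/
def ofIsometries (A : G → (H →ₗᵢ[ℂ] H)) (h_one : ∀ v, A 1 v = v)
    (h_mul : ∀ g k v, A (g * k) v = A g (A k v)) (h_cont : ∀ v, Continuous fun g => A g v) :
    UnitaryRep G H where
  toHom :=
    { toFun := fun g =>
        { toLinearEquiv := LinearEquiv.ofLinearMap (A g).toLinearMap (A g⁻¹).toLinearMap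
            (by ext v; simp [← h_mul, h_one]) (by ext v; simp [← h_mul, h_one])
          norm_map' := fun v => (A g).norm_map v }
      map_one' := by ext v; exact h_one v
      map_mul' := fun g k => by ext v; exact h_mul g k v }
  strongly_continuous := h_cont

@[simp] theorem ofIsometries_apply (A : G → (H →ₗᵢ[ℂ] H)) (h1 h2 h3) (g : G) (v : H) :
    ofIsometries A h1 h2 h3 g v = A g v := rfl

/-- `π₁` and `π₂` are (unitarily) equivalent: `U π₁(g) U⁻¹ = π₂(g)` for a unitary `U`. -/
def Equivalent (π₁ : UnitaryRep G H) (π₂ : UnitaryRep G H') : Prop :=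
  ∃ U : H ≃ₗᵢ[ℂ] H', ∀ (g : G) (v : H'), U (π₁ g (U.symm v)) = π₂ g v

/-- The subspace `K` is invariant under all operators `π(g)`. -/
def IsInvariant (π : UnitaryRep G H) (K : Submodule ℂ H) : Prop :=
  ∀ g, ∀ v ∈ K, π g v ∈ K

/-- `π` is irreducible: the space is non-zero, and `{0}` and the whole space are the only closed
invariant subspaces. -/
def IsIrreducible (π : UnitaryRep G H) : Prop :=
  Nontrivial H ∧
    ∀ K : Submodule ℂ H, IsClosed (K : Set H) → π.IsInvariant K → K = ⊥ ∨ K = ⊤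

/-- The restriction of a unitary representation to an invariant subspace. -/
def restrict (π : UnitaryRep G H) (K : Submodule ℂ H) (hK : π.IsInvariant K) : UnitaryRep G K :=
  ofIsometries
    (fun g =>
      { toLinearMap := (π g).toLinearEquiv.toLinearMap.restrict (hK g)
        norm_map' := fun v => (π g).norm_map v })
    (fun v => Subtype.ext (by
      change π.toHom 1 (v : H) = v
      simp))
    (fun g k v => Subtype.ext (by
      change π.toHom (g * k) (v : H) = π.toHom g (π.toHom k (v : H))
      simp))
    (fun v => Continuous.subtype_mk (π.strongly_continuous v) _)

/-- The representation `g ↦ π (φ g)` for a continuous group homomorphism `φ`. -/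
def comp {G' : Type*} [Group G'] [TopologicalSpace G'] (π : UnitaryRep G H) (φ : G' →* G)
    (hφ : Continuous φ) : UnitaryRep G' H where
  toHom := π.toHom.comp φ
  strongly_continuous v := (π.strongly_continuous v).comp hφ

end UnitaryRep

/-! ### The characters `χ_{a,b}` -/

/-- Multiplication by a complex number of modulus one, as a linear isometry. -/
def unitScalar (H : Type*) [NormedAddCommGroup H] [InnerProductSpace ℂ H] (c : ℂ) (hc : ‖c‖ = 1) :
    H →ₗᵢ[ℂ] H where
  toLinearMap := c • LinearMap.id
  norm_map' v := by simp [norm_smul, hc]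

@[simp] theorem unitScalar_apply {H : Type*} [NormedAddCommGroup H] [InnerProductSpace ℂ H]
    (c : ℂ) (hc : ‖c‖ = 1) (v : H) : unitScalar H c hc v = c • v := rfl

/-- `e^{2 π i s}` for real `s`. -/
def expTwoPiI (s : ℝ) : ℂ := Complex.exp (2 * Real.pi * Complex.I * s)

@[simp] theorem norm_expTwoPiI (s : ℝ) : ‖expTwoPiI s‖ = 1 := by
  rw [expTwoPiI, Complex.norm_exp]; simp

@[simp] theorem expTwoPiI_zero : expTwoPiI 0 = 1 := by simp [expTwoPiI]

theorem expTwoPiI_add (s t : ℝ) : expTwoPiI (s + t) = expTwoPiI s * expTwoPiI t := by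
  rw [expTwoPiI, expTwoPiI, expTwoPiI, ← Complex.exp_add]
  congr 1
  push_cast
  ring

theorem continuous_expTwoPiI : Continuous expTwoPiI := by
  unfold expTwoPiI
  fun_prop

/-- The one-dimensional representation `χ_{a,b}(x,ω,τ) = e^{2 π i (a ⬝ x + b ⬝ ω)}` on `ℂ`. -/
def heisenbergChar {d : ℕ} (a b : EuclideanSpace ℝ (Fin d)) : UnitaryRep (Heisenberg d) ℂ :=
  UnitaryRep.ofIsometries
    (fun h => unitScalar ℂ (expTwoPiI (inner ℝ a h.x + inner ℝ b h.ω)) (norm_expTwoPiI _))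
    (fun v => by simp)
    (fun g k v => by
      simp only [unitScalar_apply, smul_eq_mul, ← mul_assoc, ← expTwoPiI_add, Heisenberg.mul_x,
        Heisenberg.mul_ω, inner_add_right]
      congr 2
      ring)
    (fun v => by
      have hx := Heisenberg.continuous_x (d := d)
      have hω := Heisenberg.continuous_ω (d := d)
      exact (continuous_expTwoPiI.comp
        ((continuous_const.inner hx).add (continuous_const.inner hω))).smul continuous_const)

/-! ### Translations, modulations and the Schrödinger representations -/

/-- The Hilbert space `L²(ℝ^d)` of complex-valued square integrable functions. -/
abbrev L2Space (d : ℕ) : Type := Lp ℂ 2 (volume : Measure (EuclideanSpace ℝ (Fin d)))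

section Schrodinger

variable {d : ℕ}

/-- The translation `T_x f (t) = f (t - x)`. -/
def translation (x : EuclideanSpace ℝ (Fin d)) : L2Space d →ₗᵢ[ℂ] L2Space d :=
  Lp.compMeasurePreservingₗᵢ ℂ (fun t => t - x) (measurePreserving_sub_right volume x)

theorem translation_coeFn (x : EuclideanSpace ℝ (Fin d)) (f : L2Space d) :
    translation x f =ᵐ[volume] fun t => f (t - x) :=
  Lp.coeFn_compMeasurePreserving f (measurePreserving_sub_right volume x)

theorem memLp_modulation (ω : EuclideanSpace ℝ (Fin d)) (f : L2Space d) :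
    MemLp (fun t => f t * expTwoPiI (inner ℝ ω t)) 2 volume := by
  have hc : Continuous fun t : EuclideanSpace ℝ (Fin d) => expTwoPiI (inner ℝ ω t) :=
    continuous_expTwoPiI.comp (continuous_const.inner continuous_id)
  refine (Lp.memLp f).of_le ((Lp.aestronglyMeasurable f).mul hc.aestronglyMeasurable) ?_
  exact Filter.Eventually.of_forall fun t => by simp

/-- The modulation `M_ω f (t) = f (t) e^{2 π i ω ⬝ t}`. -/
def modulation (ω : EuclideanSpace ℝ (Fin d)) : L2Space d →ₗᵢ[ℂ] L2Space d where
  toFun f := (memLp_modulation ω f).toLp _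
  map_add' f g := by
    rw [← MemLp.toLp_add]
    refine MemLp.toLp_congr _ _ ?_
    filter_upwards [Lp.coeFn_add f g] with t ht
    simp only [Pi.add_apply, ht]
    ring
  map_smul' c f := by
    rw [RingHom.id_apply, ← MemLp.toLp_const_smul]
    refine MemLp.toLp_congr _ _ ?_
    filter_upwards [Lp.coeFn_smul c f] with t ht
    simp only [Pi.smul_apply, ht, smul_eq_mul]
    ring
  norm_map' f := by
    change ‖(memLp_modulation ω f).toLp _‖ = ‖f‖
    rw [Lp.norm_toLp, Lp.norm_def]
    congr 1
    exact eLpNorm_congr_norm_ae (Filter.Eventually.of_forall fun t => by simp)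

theorem modulation_coeFn (ω : EuclideanSpace ℝ (Fin d)) (f : L2Space d) :
    modulation ω f =ᵐ[volume] fun t => f t * expTwoPiI (inner ℝ ω t) :=
  MemLp.coeFn_toLp (memLp_modulation ω f)

/-- The operator `ρ(x,ω,τ) = e^{2 π i τ} M_{ω/2} T_x M_{ω/2}` on `L²(ℝ^d)`. -/
def schrodingerOp (h : Heisenberg d) : L2Space d →ₗᵢ[ℂ] L2Space d :=
  (unitScalar (L2Space d) (expTwoPiI h.τ) (norm_expTwoPiI _)).comp
    ((modulation ((1 / 2 : ℝ) • h.ω)).comp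
      ((translation h.x).comp (modulation ((1 / 2 : ℝ) • h.ω))))

theorem schrodingerOp_apply (h : Heisenberg d) (f : L2Space d) :
    schrodingerOp h f = expTwoPiI h.τ •
      modulation ((1 / 2 : ℝ) • h.ω) (translation h.x (modulation ((1 / 2 : ℝ) • h.ω) f)) := rfl

theorem ae_sub_right (x : EuclideanSpace ℝ (Fin d)) {p : EuclideanSpace ℝ (Fin d) → Prop}
    (hp : ∀ᵐ t ∂volume, p t) : ∀ᵐ t ∂volume, p (t - x) :=
  (measurePreserving_sub_right volume x).quasiMeasurePreserving.ae hp

/-- Pointwise: `ρ(x,ω,τ) f (t) = e^{2 π i (τ + ω ⬝ t - x ⬝ ω / 2)} f (t - x)`. -/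
theorem schrodingerOp_coeFn (h : Heisenberg d) (f : L2Space d) :
    schrodingerOp h f =ᵐ[volume] fun t =>
      expTwoPiI (h.τ + inner ℝ h.ω t - (1 / 2 : ℝ) * inner ℝ h.x h.ω) * f (t - h.x) := by
  rw [schrodingerOp_apply]
  set g := modulation ((1 / 2 : ℝ) • h.ω) f with hg
  filter_upwards [Lp.coeFn_smul (expTwoPiI h.τ)
      (modulation ((1 / 2 : ℝ) • h.ω) (translation h.x g)),
    modulation_coeFn ((1 / 2 : ℝ) • h.ω) (translation h.x g), translation_coeFn h.x g,
    ae_sub_right h.x (modulation_coeFn ((1 / 2 : ℝ) • h.ω) f)] with t h1 h2 h3 h4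
  rw [h1, Pi.smul_apply, h2, h3, hg, h4, smul_eq_mul]
  have key : expTwoPiI (h.τ + inner ℝ h.ω t - (1 / 2 : ℝ) * inner ℝ h.x h.ω) =
      expTwoPiI h.τ * (expTwoPiI (inner ℝ ((1 / 2 : ℝ) • h.ω) (t - h.x)) *
        expTwoPiI (inner ℝ ((1 / 2 : ℝ) • h.ω) t)) := by
    rw [← expTwoPiI_add, ← expTwoPiI_add]
    congr 1
    simp only [real_inner_smul_left, inner_sub_right, real_inner_comm h.ω h.x]
    ring
  rw [key]
  ring

theorem schrodingerOp_one (f : L2Space d) : schrodingerOp 1 f = f := by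
  refine Lp.ext ?_
  filter_upwards [schrodingerOp_coeFn 1 f] with t ht
  simp [ht]

theorem schrodingerOp_mul (h k : Heisenberg d) (f : L2Space d) :
    schrodingerOp (h * k) f = schrodingerOp h (schrodingerOp k f) := by
  refine Lp.ext ?_
  filter_upwards [schrodingerOp_coeFn (h * k) f, schrodingerOp_coeFn h (schrodingerOp k f),
    ae_sub_right h.x (schrodingerOp_coeFn k f)] with t h1 h2 h3
  rw [h1, h2, h3, ← mul_assoc, ← expTwoPiI_add]
  simp only [Heisenberg.mul_x, Heisenberg.mul_ω, Heisenberg.mul_τ, inner_add_left,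
    inner_add_right, inner_sub_right, sub_sub]
  congr 2
  rw [real_inner_comm h.x k.ω]
  ring

/-- A strongly continuous family of isometries is jointly continuous. -/
theorem continuous_isometry_apply {X E : Type*} [TopologicalSpace X] [NormedAddCommGroup E]
    [NormedSpace ℂ E] {A : X → (E →ₗᵢ[ℂ] E)} (hA : ∀ v, Continuous fun a => A a v) {g : X → E}
    (hg : Continuous g) : Continuous fun a => A a (g a) := by
  rw [continuous_iff_continuousAt]
  intro a
  have h1 : Filter.Tendsto (fun b => A b (g b - g a)) (nhds a) (nhds 0) := by
    rw [tendsto_zero_iff_norm_tendsto_zero]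
    simp only [LinearIsometry.norm_map]
    have := (hg.tendsto a).sub_const (g a)
    rw [sub_self] at this
    simpa using this.norm
  have h2 := h1.add ((hA (g a)).tendsto a)
  simpa [ContinuousAt] using h2

theorem continuous_translation (f : L2Space d) :
    Continuous fun x : EuclideanSpace ℝ (Fin d) => translation x f := by
  have hg : Continuous fun x : EuclideanSpace ℝ (Fin d) =>
      (⟨fun t => t - x, by fun_prop⟩ : C(EuclideanSpace ℝ (Fin d), EuclideanSpace ℝ (Fin d))) :=
    ContinuousMap.continuous_of_continuous_uncurry _
      (by simp only [Function.uncurry_def, ContinuousMap.coe_mk]; fun_prop)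
  exact Continuous.compMeasurePreservingLp (continuous_const (y := f)) hg
    (fun x => measurePreserving_sub_right volume x) (by simp)

theorem continuous_modulation (f : L2Space d) :
    Continuous fun ω : EuclideanSpace ℝ (Fin d) => modulation ω f := by
  rw [continuous_iff_continuousAt]
  intro ω₀
  have hsq : ∀ ω, ‖modulation ω f - modulation ω₀ f‖ ^ 2 =
      ∫ t, (‖f t‖ * ‖expTwoPiI (inner ℝ ω t) - expTwoPiI (inner ℝ ω₀ t)‖) ^ 2 := by
    intro ω
    rw [← inner_self_eq_norm_sq (𝕜 := ℂ), L2.inner_def, ← integral_re (L2.integrable_inner _ _)]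
    refine integral_congr_ae ?_
    filter_upwards [Lp.coeFn_sub (modulation ω f) (modulation ω₀ f), modulation_coeFn ω f,
      modulation_coeFn ω₀ f] with t h1 h2 h3
    rw [inner_self_eq_norm_sq, h1, Pi.sub_apply, h2, h3, ← mul_sub, norm_mul]
  have hcont : Continuous fun ω : EuclideanSpace ℝ (Fin d) =>
      ∫ t, (‖f t‖ * ‖expTwoPiI (inner ℝ ω t) - expTwoPiI (inner ℝ ω₀ t)‖) ^ 2 := by
    have hf2 : Integrable (fun t => ‖f t‖ ^ 2) volume := (Lp.memLp f).integrable_norm_pow (by simp)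
    refine continuous_of_dominated (bound := fun t => 4 * ‖f t‖ ^ 2) ?_ ?_ (hf2.const_mul 4) ?_
    · intro ω
      have hc : Continuous fun t : EuclideanSpace ℝ (Fin d) =>
          ‖expTwoPiI (inner ℝ ω t) - expTwoPiI (inner ℝ ω₀ t)‖ :=
        ((continuous_expTwoPiI.comp (continuous_const.inner continuous_id)).sub
          (continuous_expTwoPiI.comp (continuous_const.inner continuous_id))).norm
      exact ((Lp.aestronglyMeasurable f).norm.mul hc.aestronglyMeasurable).pow 2
    · intro ω
      refine Filter.Eventually.of_forall fun t => ?_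
      have h2 : ‖expTwoPiI (inner ℝ ω t) - expTwoPiI (inner ℝ ω₀ t)‖ ≤ 2 :=
        (norm_sub_le _ _).trans (by simp; norm_num)
      rw [Real.norm_eq_abs, abs_of_nonneg (by positivity), mul_pow, mul_comm]
      gcongr
      nlinarith [norm_nonneg (expTwoPiI (inner ℝ ω t) - expTwoPiI (inner ℝ ω₀ t))]
    · refine Filter.Eventually.of_forall fun t => ?_
      exact (continuous_const.mul
        (((continuous_expTwoPiI.comp (continuous_id.inner continuous_const)).sub
          continuous_const).norm)).pow 2
  have hlim := (hcont.tendsto ω₀).sqrt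
  simp only [← hsq, Real.sqrt_sq (norm_nonneg _)] at hlim
  rw [ContinuousAt, tendsto_iff_norm_sub_tendsto_zero]
  simpa using hlim

theorem continuous_schrodingerOp (f : L2Space d) :
    Continuous fun h : Heisenberg d => schrodingerOp h f := by
  have hω : Continuous fun h : Heisenberg d => (1 / 2 : ℝ) • h.ω :=
    (continuous_const_smul (1 / 2 : ℝ)).comp Heisenberg.continuous_ω
  have h1 : Continuous fun h : Heisenberg d => modulation ((1 / 2 : ℝ) • h.ω) f :=
    (continuous_modulation f).comp hω
  have h2 : Continuous fun h : Heisenberg d =>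
      translation h.x (modulation ((1 / 2 : ℝ) • h.ω) f) :=
    continuous_isometry_apply (A := fun h : Heisenberg d => translation h.x)
      (fun v => (continuous_translation v).comp Heisenberg.continuous_x) h1
  have h3 := continuous_isometry_apply
    (A := fun h : Heisenberg d => modulation ((1 / 2 : ℝ) • h.ω))
    (fun v => (continuous_modulation v).comp hω) h2
  exact (continuous_expTwoPiI.comp Heisenberg.continuous_τ).smul h3

variable (d) in
/-- The Schrödinger representation `ρ` of the Heisenberg group on `L²(ℝ^d)`. -/
def schrodinger : UnitaryRep (Heisenberg d) (L2Space d) :=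
  UnitaryRep.ofIsometries schrodingerOp schrodingerOp_one schrodingerOp_mul
    continuous_schrodingerOp

variable (d) in
/-- The representation `ρ_κ = ρ ∘ δ_κ`, that is `ρ_κ(x,ω,τ) = ρ(κ x, ω, κ τ)`. -/
def schrodingerRep (κ : ℝ) : UnitaryRep (Heisenberg d) (L2Space d) :=
  (schrodinger d).comp (Heisenberg.dilation κ) (Heisenberg.continuous_dilation κ)

end Schrodinger

end

/-!
# The Stone–von Neumann theorem

The proof is von Neumann's. Let `π` be a unitary representation of the Heisenberg group whose
centre acts by `e^{2πiτ}`, and let `P = ∫ φ(z) π(z, 0) dz` be the average of `π` against the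
Gaussian `φ(x, ω) = e^{-π (|x|² + |ω|²) / 2}` on phase space. The Gaussian is a minimal idempotent
for twisted convolution, which for `P` means
`P π(h) P = c(h) P` with `c(x, ω, τ) = e^{2πiτ} φ(x, ω)`
(`gaussianProjection_map_gaussianProjection`; the underlying Gaussian integral is
`integral_phaseGaussian_mul_phaseGaussian`). So `P` is an orthogonal projection, and
`⟪u, π(h) v⟫ = c(h) ⟪u, v⟫` for `u`, `v` in its range. Uniqueness for the Fourier transform shows
that `P` does not vanish on the whole orbit of a non-zero vector
(`eq_zero_of_forall_gaussianProjection_map_eq_zero`).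

Hence the closed subspaces generated by the orbits of an orthonormal basis of the range of `P` are
pairwise orthogonal and span the whole space. Each of them is cyclic with matrix coefficient `c`,
which does not depend on `π`, and a cyclic representation is determined by its matrix coefficient
(`UnitaryRep.equivalent_of_inner_eq`). The Schrödinger representation is irreducible, because
orthogonality of `g` to all time-frequency shifts of `f` forces `f(t - x) g(t) = 0` for almost all
`t`, for each `x`, and hence `f = 0` or `g = 0`. So it is itself cyclic with matrix coefficient `c`,
and all the summands are equivalent to it. This is `exists_isHilbertSum_equivalent_schrodinger`.

For an irreducible representation Schur's lemma, proved with the continuous functional calculus,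
makes the centre act by a continuous character `e^{2πiκτ}`. If `κ = 0` all operators commute, are
therefore scalars, and form a character of `ℝ^d × ℝ^d`. If `κ ≠ 0` the dilation `δ_{1/κ}` reduces to
the case `κ = 1`. The representations of the list are told apart by the scalars by which `(0, 0, τ)`
acts and, for the characters, by their values.
-/

noncomputable section

/-! ### Uniqueness for the Fourier transform of integrable functions -/

section Fourier

variable {V W : Type*} [AddCommGroup V] [Module ℝ V] [PseudoEMetricSpace V] [MeasurableSpace V]
  [BorelSpace V] [CompleteSpace V] [SecondCountableTopology V]
  [AddCommGroup W] [Module ℝ W] [TopologicalSpace W] {L : V →ₗ[ℝ] W →ₗ[ℝ] ℝ} {μ : Measure V}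

theorem expTwoPiI_eq_probChar (s : ℝ) : expTwoPiI s = Real.probChar (2 * Real.pi * s) := by
  rw [expTwoPiI, Real.probChar_apply]
  congr 1
  push_cast
  ring

theorem expTwoPiI_neg (s : ℝ) : expTwoPiI (-s) = starRingEnd ℂ (expTwoPiI s) := by
  rw [expTwoPiI, expTwoPiI, ← Complex.exp_conj]
  congr 1
  simp [map_ofNat]

theorem ae_eq_zero_of_forall_integral_expTwoPiI_mul_real_eq_zero (hL : ∀ v ≠ 0, L v ≠ 0)
    (hLc : Continuous fun p : V × W => L p.1 p.2) {g : V → ℝ} (hg : Integrable g μ)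
    (h : ∀ w, ∫ v, expTwoPiI (L v w) * (g v : ℂ) ∂μ = 0) : g =ᵐ[μ] 0 := by
  have := isFiniteMeasure_withDensity_ofReal hg.2
  have := isFiniteMeasure_withDensity_ofReal hg.neg.2
  have hP : μ.withDensity (fun v => ENNReal.ofReal (g v)) =
      μ.withDensity (fun v => ENNReal.ofReal ((-g) v)) := by
    refine ext_of_integral_char_eq Real.continuous_probChar Real.probChar_ne_one hL hLc fun w => ?_
    have key : ∀ f : V → ℝ, Integrable f μ → Integrable (fun v => (max (f v) 0) •
        BoundedContinuousFunction.char Real.continuous_probChar hLc w v) μ := by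
      intro f hf
      refine hf.pos_part.smul_bdd (C := 1) ?_ ?_
      · exact (BoundedContinuousFunction.continuous _).aestronglyMeasurable
      · exact Filter.Eventually.of_forall fun v => (Circle.norm_coe _).le
    rw [integral_withDensity_eq_integral_toReal_smul₀ hg.1.aemeasurable.ennreal_ofReal (by simp),
      integral_withDensity_eq_integral_toReal_smul₀ hg.neg.1.aemeasurable.ennreal_ofReal (by simp)]
    simp only [ENNReal.toReal_ofReal']
    rw [← sub_eq_zero, ← integral_sub (key g hg) (key _ hg.neg)]
    rw [← h ((2 * Real.pi)⁻¹ • w)]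
    refine integral_congr_ae (Filter.Eventually.of_forall fun v => ?_)
    simp only [BoundedContinuousFunction.char_apply, map_smul, smul_eq_mul, Pi.neg_apply]
    rw [← sub_smul, max_zero_sub_eq_self, expTwoPiI_eq_probChar, Complex.real_smul, mul_comm,
      mul_inv_cancel_left₀ Real.two_pi_pos.ne']
  have hne : ∫⁻ v, ENNReal.ofReal (g v) ∂μ ≠ ⊤ := by
    have := measure_ne_top (μ.withDensity fun v => ENNReal.ofReal (g v)) Set.univ
    rwa [withDensity_apply _ MeasurableSet.univ, Measure.restrict_univ] at this
  rw [withDensity_eq_iff hg.1.aemeasurable.ennreal_ofReal hg.neg.1.aemeasurable.ennreal_ofReal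
    hne] at hP
  filter_upwards [hP] with v hv
  simp only [Pi.neg_apply, Pi.zero_apply] at hv ⊢
  rcases le_total 0 (g v) with h0 | h0
  · rw [ENNReal.ofReal_of_nonpos (neg_nonpos.2 h0), ENNReal.ofReal_eq_zero] at hv
    exact le_antisymm hv h0
  · rw [ENNReal.ofReal_of_nonpos h0, eq_comm, ENNReal.ofReal_eq_zero, neg_nonpos] at hv
    exact le_antisymm h0 hv

/-- An integrable function all of whose Fourier coefficients vanish is zero almost everywhere.
The pairing `L` is arbitrary because it is used both for the inner product of `ℝ^d` and for the
symplectic form of `ℝ^d × ℝ^d`. -/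
theorem ae_eq_zero_of_forall_integral_expTwoPiI_mul_eq_zero (hL : ∀ v ≠ 0, L v ≠ 0)
    (hLc : Continuous fun p : V × W => L p.1 p.2) {f : V → ℂ} (hf : Integrable f μ)
    (h : ∀ w, ∫ v, expTwoPiI (L v w) * f v ∂μ = 0) : f =ᵐ[μ] 0 := by
  have hint : ∀ {g : V → ℂ}, Integrable g μ → ∀ w : W,
      Integrable (fun v => expTwoPiI (L v w) * g v) μ := by
    intro g hg w
    refine hg.bdd_mul (c := 1) ?_ (Filter.Eventually.of_forall fun v => by simp)
    exact (continuous_expTwoPiI.comp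
      (hLc.comp (Continuous.prodMk_left w))).aestronglyMeasurable
  -- the Fourier coefficients of the complex conjugate vanish too
  have hconj : ∀ w, ∫ v, expTwoPiI (L v w) * starRingEnd ℂ (f v) ∂μ = 0 := by
    intro w
    have := congrArg (starRingEnd ℂ) (h (-w))
    rw [← integral_conj, map_zero] at this
    simpa [expTwoPiI_neg] using this
  have hconjint : Integrable (fun v => starRingEnd ℂ (f v)) μ :=
    (Complex.conjLIE.integrable_comp_iff (φ := f)).2 hf
  have hre := ae_eq_zero_of_forall_integral_expTwoPiI_mul_real_eq_zero hL hLc hf.re (by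
    intro w
    have h2 := integral_add (hint hf w) (hint hconjint w)
    rw [h, hconj, add_zero] at h2
    have h3 : ∀ v, expTwoPiI (L v w) * ((RCLike.re (f v) : ℝ) : ℂ) =
        (1 / 2 : ℂ) * (expTwoPiI (L v w) * f v + expTwoPiI (L v w) * starRingEnd ℂ (f v)) := by
      intro v
      have := Complex.add_conj (f v)
      rw [← mul_add, this]
      simp
      ring
    simp_rw [h3]
    rw [integral_const_mul, h2, mul_zero])
  have him := ae_eq_zero_of_forall_integral_expTwoPiI_mul_real_eq_zero hL hLc hf.im (by
    intro w
    have h2 := integral_sub (hint hf w) (hint hconjint w)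
    rw [h, hconj, sub_zero] at h2
    have h3 : ∀ v, expTwoPiI (L v w) * ((RCLike.im (f v) : ℝ) : ℂ) =
        (1 / (2 * Complex.I) : ℂ) *
          (expTwoPiI (L v w) * f v - expTwoPiI (L v w) * starRingEnd ℂ (f v)) := by
      intro v
      have := Complex.sub_conj (f v)
      rw [← mul_sub, this]
      field_simp
      simp
      ring
    simp_rw [h3]
    rw [integral_const_mul, h2, mul_zero])
  filter_upwards [hre, him] with v h1 h2
  exact Complex.ext h1 h2

end Fourier

/-! ### The Gaussian on phase space -/

section Gaussian

variable {V : Type*} [NormedAddCommGroup V]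

/-- The Gaussian `e^{-π (|x|² + |ω|²) / 2}` on phase space, with complex values. -/
def phaseGaussian (z : V × V) : ℂ :=
  Complex.exp (-(Real.pi / 2) * (‖z.1‖ ^ 2 + ‖z.2‖ ^ 2))

@[simp] theorem phaseGaussian_zero : phaseGaussian (0 : V × V) = 1 := by simp [phaseGaussian]

theorem phaseGaussian_neg (z : V × V) : phaseGaussian (-z) = phaseGaussian z := by
  simp [phaseGaussian]

theorem conj_phaseGaussian (z : V × V) : starRingEnd ℂ (phaseGaussian z) = phaseGaussian z := by
  rw [phaseGaussian, ← Complex.exp_conj]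
  congr 1
  simp [map_ofNat]

theorem continuous_phaseGaussian : Continuous (phaseGaussian : V × V → ℂ) := by
  unfold phaseGaussian
  fun_prop

variable [InnerProductSpace ℝ V] [FiniteDimensional ℝ V] [MeasurableSpace V] [BorelSpace V]

theorem isAddHaarMeasure_volume_prod : (volume : Measure (V × V)).IsAddHaarMeasure := by
  rw [Measure.volume_eq_prod]
  infer_instance

theorem integrable_phaseGaussian : Integrable (phaseGaussian : V × V → ℂ) := by
  have h : Integrable (fun x : V => Complex.exp (-(Real.pi / 2 : ℂ) * ‖x‖ ^ 2)) := by
    have := GaussianFourier.integrable_cexp_neg_mul_sq_norm_add (V := V) (b := Real.pi / 2)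
      (by simp [Real.pi_pos]) 0 0
    simpa using this
  refine (h.mul_prod h).congr (Filter.Eventually.of_forall fun z => ?_)
  simp only [phaseGaussian, ← Complex.exp_add]
  congr 1
  ring

theorem integral_gaussian_mul_expTwoPiI (s : V) :
    ∫ y : V, Complex.exp (-Real.pi * ‖y‖ ^ 2) * expTwoPiI ((1 / 2 : ℝ) * inner ℝ s y) =
      Complex.exp (-(Real.pi / 4) * ‖s‖ ^ 2) := by
  have := GaussianFourier.integral_cexp_neg_mul_sq_norm_add (V := V) (b := Real.pi)
    (by simp [Real.pi_pos]) (Real.pi * Complex.I) s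
  have hpi : (Real.pi : ℂ) ≠ 0 := by exact_mod_cast Real.pi_ne_zero
  rw [div_self hpi, Complex.one_cpow, one_mul] at this
  convert this using 2
  · ext y
    rw [expTwoPiI, ← Complex.exp_add]
    congr 1
    push_cast
    ring
  · field_simp
    rw [Complex.I_sq]
    ring

/-- The Gaussian is, up to scalars, a minimal idempotent for twisted convolution: the twisted
convolution of two copies of it, one shifted by `w`, is a multiple of it. -/
theorem integral_phaseGaussian_mul_phaseGaussian (w u : V × V) :
    ∫ z : V × V, phaseGaussian z * phaseGaussian (u - z - w) *
        expTwoPiI ((1 / 2 : ℝ) * (inner ℝ (w.1 + u.1) z.2 - inner ℝ (w.2 + u.2) z.1 +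
          inner ℝ u.1 w.2 - inner ℝ w.1 u.2)) =
      phaseGaussian w * phaseGaussian u := by
  obtain ⟨a, b⟩ := w
  obtain ⟨X, Y⟩ := u
  have := isAddHaarMeasure_volume_prod (V := V)
  -- the substitution `z ↦ z + (u - w) / 2` completes the squares
  rw [← integral_add_right_eq_self _ (((1 / 2 : ℝ) • (X - a), (1 / 2 : ℝ) • (Y - b)) : V × V)]
  have hpt : ∀ z : V × V,
      phaseGaussian (z + ((1 / 2 : ℝ) • (X - a), (1 / 2 : ℝ) • (Y - b))) *
        phaseGaussian ((X, Y) - (z + ((1 / 2 : ℝ) • (X - a), (1 / 2 : ℝ) • (Y - b))) - (a, b)) *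
        expTwoPiI ((1 / 2 : ℝ) *
          (inner ℝ (a + X) (z + ((1 / 2 : ℝ) • (X - a), (1 / 2 : ℝ) • (Y - b))).2 -
          inner ℝ (b + Y) (z + ((1 / 2 : ℝ) • (X - a), (1 / 2 : ℝ) • (Y - b))).1 +
          inner ℝ X b - inner ℝ a Y)) =
      Complex.exp (-(Real.pi / 4) * (‖X - a‖ ^ 2 + ‖Y - b‖ ^ 2)) *
        ((Complex.exp (-Real.pi * ‖z.1‖ ^ 2) * expTwoPiI ((1 / 2 : ℝ) * inner ℝ (-(b + Y)) z.1)) *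
        (Complex.exp (-Real.pi * ‖z.2‖ ^ 2) * expTwoPiI ((1 / 2 : ℝ) * inner ℝ (a + X) z.2))) := by
    rintro ⟨x, y⟩
    simp only [phaseGaussian, expTwoPiI, ← Complex.exp_add, Prod.mk_add_mk, Prod.mk_sub_mk]
    congr 1
    have e1 : X - (x + (1 / 2 : ℝ) • (X - a)) - a = (1 / 2 : ℝ) • (X - a) - x := by module
    have e2 : Y - (y + (1 / 2 : ℝ) • (Y - b)) - b = (1 / 2 : ℝ) • (Y - b) - y := by module
    have n1 : ‖x + (1 / 2 : ℝ) • (X - a)‖ ^ 2 + ‖(1 / 2 : ℝ) • (X - a) - x‖ ^ 2 =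
        2 * ‖x‖ ^ 2 + ‖X - a‖ ^ 2 / 2 := by
      rw [norm_add_sq_real, norm_sub_sq_real, norm_smul, real_inner_comm x]
      norm_num
      ring
    have n2 : ‖y + (1 / 2 : ℝ) • (Y - b)‖ ^ 2 + ‖(1 / 2 : ℝ) • (Y - b) - y‖ ^ 2 =
        2 * ‖y‖ ^ 2 + ‖Y - b‖ ^ 2 / 2 := by
      rw [norm_add_sq_real, norm_sub_sq_real, norm_smul, real_inner_comm y]
      norm_num
      ring
    have i1 : inner ℝ (a + X) (y + (1 / 2 : ℝ) • (Y - b)) -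
        inner ℝ (b + Y) (x + (1 / 2 : ℝ) • (X - a)) + inner ℝ X b - inner ℝ a Y =
        inner ℝ (a + X) y + inner ℝ (-(b + Y)) x := by
      simp only [inner_add_left, inner_add_right, inner_sub_right, inner_neg_left,
        real_inner_smul_right, real_inner_comm a b, real_inner_comm a Y, real_inner_comm X b,
        real_inner_comm X Y]
      ring
    rw [e1, e2, i1]
    have n1' := congrArg (Complex.ofReal) n1
    have n2' := congrArg (Complex.ofReal) n2
    push_cast at n1' n2' ⊢
    linear_combination (-(Real.pi : ℂ) / 2) * n1' + (-(Real.pi : ℂ) / 2) * n2'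
  simp only [hpt]
  rw [integral_const_mul, Measure.volume_eq_prod,
    integral_prod_mul (μ := (volume : Measure V)) (ν := (volume : Measure V))
      (fun x : V => Complex.exp (-Real.pi * ‖x‖ ^ 2) *
        expTwoPiI ((1 / 2 : ℝ) * inner ℝ (-(b + Y)) x))
      (fun y : V => Complex.exp (-Real.pi * ‖y‖ ^ 2) *
        expTwoPiI ((1 / 2 : ℝ) * inner ℝ (a + X) y)),
    integral_gaussian_mul_expTwoPiI, integral_gaussian_mul_expTwoPiI]
  simp only [phaseGaussian, ← Complex.exp_add]
  congr 1
  have n1 := congrArg (Complex.ofReal) (parallelogram_law_with_norm ℝ X a)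
  have n2 := congrArg (Complex.ofReal) (parallelogram_law_with_norm ℝ Y b)
  rw [norm_neg, add_comm a X, add_comm b Y]
  push_cast at n1 n2
  linear_combination (-(Real.pi : ℂ) / 4) * n1 + (-(Real.pi : ℂ) / 4) * n2

end Gaussian

/-! ### Continuous characters of the real line -/

/-- Averaging over a short interval shows that a continuous character is differentiable, so it
solves `c' = c'(0) c`. -/
theorem exists_eq_expTwoPiI_of_continuous {c : ℝ → ℂ} (hc : Continuous c) (hnorm : ∀ t, ‖c t‖ = 1)
    (hadd : ∀ s t, c (s + t) = c s * c t) : ∃ κ : ℝ, ∀ t, c t = expTwoPiI (κ * t) := by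
  have h0 : c 0 = 1 := by
    have h1 := hadd 0 0
    have h2 : c 0 ≠ 0 := by
      intro h
      simpa [h] using hnorm 0
    rw [add_zero] at h1
    exact (mul_eq_left₀ h2).1 h1.symm
  have hint : ∀ a b, IntervalIntegrable c volume a b := fun a b => hc.intervalIntegrable a b
  have hF : ∀ t, HasDerivAt (fun t => ∫ s in (0 : ℝ)..t, c s) (c t) t := fun t =>
    intervalIntegral.integral_hasDerivAt_right (hint _ _) (hc.stronglyMeasurableAtFilter _ _)
      hc.continuousAt
  obtain ⟨δ, hδ⟩ : ∃ δ : ℝ, (∫ s in (0 : ℝ)..δ, c s) ≠ 0 := by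
    by_contra! h
    have h1 := hF 0
    rw [show (fun t => ∫ s in (0 : ℝ)..t, c s) = fun _ => 0 from funext h, h0] at h1
    exact one_ne_zero (h1.unique (hasDerivAt_const _ _))
  set A := ∫ s in (0 : ℝ)..δ, c s with hA
  have hshift : ∀ t, c t = A⁻¹ * ((∫ s in (0 : ℝ)..t + δ, c s) - ∫ s in (0 : ℝ)..t, c s) := by
    intro t
    rw [intervalIntegral.integral_interval_sub_left (hint _ _) (hint _ _)]
    have : ∫ s in t..t + δ, c s = c t * A := by
      rw [hA, ← intervalIntegral.integral_const_mul]
      simp only [← hadd]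
      rw [intervalIntegral.integral_comp_add_left (fun s => c s), add_zero]
    rw [this, mul_comm (c t), inv_mul_cancel_left₀ hδ]
  have hdiff : Differentiable ℝ c := by
    intro t
    rw [show c = _ from funext hshift]
    exact ((((hF (t + δ)).comp_add_const t δ).sub (hF t)).const_mul A⁻¹).differentiableAt
  set l := deriv c 0 with hl
  have hderiv : ∀ t, HasDerivAt c (c t * l) t := by
    intro t
    have h1 : HasDerivAt (fun s => c t * c (s - t)) (c t * l) t := by
      refine HasDerivAt.const_mul _ ?_
      have h2 := (hdiff 0).hasDerivAt
      rw [← sub_self t] at h2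
      have h3 := h2.comp_sub_const t t
      rwa [sub_self] at h3
    refine h1.congr_of_eventuallyEq (Filter.Eventually.of_forall fun s => ?_)
    simp only [← hadd, add_sub_cancel]
  have hexp : ∀ t : ℝ, c t = Complex.exp (l * t) := by
    have hd : ∀ t : ℝ, HasDerivAt (fun t : ℝ => c t * Complex.exp (-l * t)) 0 t := by
      intro t
      have h1 : HasDerivAt (fun t : ℝ => Complex.exp (-l * t)) (Complex.exp (-l * t) * (-l)) t := by
        have := ((hasDerivAt_id (t : ℂ)).const_mul (-l)).cexp.comp_ofReal
        simpa using this
      refine ((hderiv t).mul h1).congr_deriv ?_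
      ring
    have hconst := is_const_of_deriv_eq_zero (fun t => (hd t).differentiableAt)
      (fun t => (hd t).deriv)
    intro t
    have := hconst t 0
    simp only [h0, Complex.ofReal_zero, mul_zero, Complex.exp_zero, mul_one] at this
    rw [neg_mul, Complex.exp_neg] at this
    exact (mul_inv_eq_one₀ (Complex.exp_ne_zero _)).1 this
  have hre : l.re = 0 := by
    have := hnorm 1
    rw [hexp, Complex.norm_exp] at this
    simpa using this
  refine ⟨l.im / (2 * Real.pi), fun t => ?_⟩
  rw [hexp, expTwoPiI]
  congr 1
  have hpi : (Real.pi : ℂ) ≠ 0 := by exact_mod_cast Real.pi_ne_zero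
  have : l = l.im * Complex.I := Complex.ext (by simp [hre]) (by simp)
  rw [this]
  push_cast
  simp
  field_simp

theorem eq_zero_of_forall_expTwoPiI_mul_eq_one {s : ℝ} (h : ∀ t : ℝ, expTwoPiI (s * t) = 1) :
    s = 0 := by
  have h1 : HasDerivAt (fun t : ℝ => expTwoPiI (s * t)) (2 * Real.pi * Complex.I * s) 0 := by
    have h2 := ((hasDerivAt_id ((0 : ℝ) : ℂ)).const_mul
      (2 * Real.pi * Complex.I * s)).cexp.comp_ofReal
    simp only [id, Complex.ofReal_zero, mul_zero, Complex.exp_zero, one_mul, mul_one] at h2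
    refine h2.congr_of_eventuallyEq (Filter.Eventually.of_forall fun t => ?_)
    simp only [expTwoPiI]
    congr 1
    push_cast
    ring
  rw [funext h] at h1
  have h3 := h1.unique (hasDerivAt_const _ _)
  simpa [Real.pi_ne_zero] using h3

/-! ### Cyclic representations -/

namespace UnitaryRep

section General

variable {G : Type*} [Group G] [TopologicalSpace G]
variable {H : Type*} [NormedAddCommGroup H] [InnerProductSpace ℂ H]
variable {H' : Type*} [NormedAddCommGroup H'] [InnerProductSpace ℂ H']
variable {H'' : Type*} [NormedAddCommGroup H''] [InnerProductSpace ℂ H'']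

theorem map_mul_apply (π : UnitaryRep G H) (g k : G) (v : H) : π (g * k) v = π g (π k v) := by
  rw [map_mul]; rfl

theorem map_one_apply (π : UnitaryRep G H) (v : H) : π 1 v = v := by
  rw [map_one]; rfl

theorem inner_map_left (π : UnitaryRep G H) (g : G) (u v : H) :
    inner ℂ (π g u) v = inner ℂ u (π g⁻¹ v) := by
  rw [← (π g).inner_map_map u, ← map_mul_apply, mul_inv_cancel, map_one_apply]

theorem inner_map_map' (π : UnitaryRep G H) (g k : G) (u v : H) :
    inner ℂ (π g u) (π k v) = inner ℂ u (π (g⁻¹ * k) v) := by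
  rw [inner_map_left, ← map_mul_apply]

theorem Equivalent.symm {π₁ : UnitaryRep G H} {π₂ : UnitaryRep G H'} (h : π₁.Equivalent π₂) :
    π₂.Equivalent π₁ := by
  obtain ⟨U, hU⟩ := h
  refine ⟨U.symm, fun g v => ?_⟩
  rw [LinearIsometryEquiv.symm_symm, ← hU, U.symm_apply_apply, U.symm_apply_apply]

theorem Equivalent.trans {π₁ : UnitaryRep G H} {π₂ : UnitaryRep G H'} {π₃ : UnitaryRep G H''}
    (h : π₁.Equivalent π₂) (h' : π₂.Equivalent π₃) : π₁.Equivalent π₃ := by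
  obtain ⟨U, hU⟩ := h
  obtain ⟨T, hT⟩ := h'
  refine ⟨U.trans T, fun g v => ?_⟩
  rw [← hT, ← hU]
  rfl

/-- The closed subspace generated by the orbit of `v`. -/
def cyclicSubspace (π : UnitaryRep G H) (v : H) : Submodule ℂ H :=
  (Submodule.span ℂ (Set.range fun g => π g v)).topologicalClosure

theorem isClosed_cyclicSubspace (π : UnitaryRep G H) (v : H) :
    IsClosed (π.cyclicSubspace v : Set H) := Submodule.isClosed_topologicalClosure _

theorem apply_mem_cyclicSubspace (π : UnitaryRep G H) (g : G) (v : H) :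
    π g v ∈ π.cyclicSubspace v :=
  Submodule.le_topologicalClosure _ (Submodule.subset_span ⟨g, rfl⟩)

theorem mem_cyclicSubspace (π : UnitaryRep G H) (v : H) : v ∈ π.cyclicSubspace v := by
  simpa [map_one_apply] using π.apply_mem_cyclicSubspace 1 v

theorem cyclicSubspace_le {π : UnitaryRep G H} {v : H} {K : Submodule ℂ H}
    (hK : IsClosed (K : Set H)) (h : ∀ g, π g v ∈ K) : π.cyclicSubspace v ≤ K :=
  Submodule.topologicalClosure_minimal _
    (Submodule.span_le.2 (by rintro _ ⟨g, rfl⟩; exact h g)) hK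

theorem isInvariant_cyclicSubspace (π : UnitaryRep G H) (v : H) :
    π.IsInvariant (π.cyclicSubspace v) := by
  intro g
  have hclosed : IsClosed
      (((π.cyclicSubspace v).comap (π g).toLinearEquiv.toLinearMap : Submodule ℂ H) : Set H) :=
    (π.isClosed_cyclicSubspace v).preimage (π g).continuous
  refine cyclicSubspace_le hclosed fun k => ?_
  change π g (π k v) ∈ π.cyclicSubspace v
  rw [← map_mul_apply]
  exact π.apply_mem_cyclicSubspace _ v

theorem inner_eq_zero_of_mem_cyclicSubspace {π : UnitaryRep G H} {u v x y : H}
    (h : ∀ g, inner ℂ u (π g v) = 0) (hx : x ∈ π.cyclicSubspace u)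
    (hy : y ∈ π.cyclicSubspace v) : inner ℂ x y = 0 := by
  have h1 : π.cyclicSubspace v ≤ (π.cyclicSubspace u)ᗮ := by
    refine cyclicSubspace_le (Submodule.isClosed_orthogonal _) fun g => ?_
    have h2 : π.cyclicSubspace u ≤ (ℂ ∙ π g v)ᗮ := by
      refine cyclicSubspace_le (Submodule.isClosed_orthogonal _) fun k => ?_
      rw [Submodule.mem_orthogonal_singleton_iff_inner_left, inner_map_map', h]
    rw [Submodule.mem_orthogonal]
    intro w hw
    exact Submodule.mem_orthogonal_singleton_iff_inner_left.1 (h2 hw)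
  exact Submodule.inner_right_of_mem_orthogonal hx (h1 hy)

theorem norm_linearCombination_eq {π₁ : UnitaryRep G H} {π₂ : UnitaryRep G H'} {v₁ : H} {v₂ : H'}
    (h : ∀ g, inner ℂ v₁ (π₁ g v₁) = inner ℂ v₂ (π₂ g v₂)) (c : G →₀ ℂ) :
    ‖Finsupp.linearCombination ℂ (fun g => π₂ g v₂) c‖ =
      ‖Finsupp.linearCombination ℂ (fun g => π₁ g v₁) c‖ := by
  have : (inner ℂ (Finsupp.linearCombination ℂ (fun g => π₂ g v₂) c)
      (Finsupp.linearCombination ℂ (fun g => π₂ g v₂) c) : ℂ) =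
      inner ℂ (Finsupp.linearCombination ℂ (fun g => π₁ g v₁) c)
      (Finsupp.linearCombination ℂ (fun g => π₁ g v₁) c) := by
    simp only [Finsupp.linearCombination_apply, Finsupp.sum, sum_inner, inner_sum,
      inner_smul_left, inner_smul_right, inner_map_map', h]
  rw [inner_self_eq_norm_sq_to_K, inner_self_eq_norm_sq_to_K] at this
  exact (sq_eq_sq₀ (norm_nonneg _) (norm_nonneg _)).1 (by exact_mod_cast this)

/-- A cyclic representation is determined up to equivalence by the matrix coefficient of its
cyclic vector. -/
theorem equivalent_of_inner_eq [CompleteSpace H] [CompleteSpace H'] {π₁ : UnitaryRep G H}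
    {π₂ : UnitaryRep G H'} {v₁ : H} {v₂ : H'} (h₁ : π₁.cyclicSubspace v₁ = ⊤)
    (h₂ : π₂.cyclicSubspace v₂ = ⊤)
    (h : ∀ g, inner ℂ v₁ (π₁ g v₁) = inner ℂ v₂ (π₂ g v₂)) : π₁.Equivalent π₂ := by
  have d₁ : DenseRange (Finsupp.linearCombination ℂ (fun g => π₁ g v₁)) := by
    rw [DenseRange, ← LinearMap.coe_range, Finsupp.range_linearCombination]
    exact Submodule.dense_iff_topologicalClosure_eq_top.2 h₁
  have d₂ : DenseRange (Finsupp.linearCombination ℂ (fun g => π₂ g v₂)) := by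
    rw [DenseRange, ← LinearMap.coe_range, Finsupp.range_linearCombination]
    exact Submodule.dense_iff_topologicalClosure_eq_top.2 h₂
  let U : H ≃ₗᵢ[ℂ] H' := (LinearEquiv.refl ℂ (G →₀ ℂ)).extendOfIsometry _ _ d₁ d₂
    (norm_linearCombination_eq h)
  have hU : ∀ g, U (π₁ g v₁) = π₂ g v₂ := by
    intro g
    have := LinearEquiv.extendOfIsometry_eq (LinearEquiv.refl ℂ (G →₀ ℂ)) _ _ d₁ d₂
      (norm_linearCombination_eq h) (Finsupp.single g 1)
    simpa using this
  have hcomm : ∀ g v, U (π₁ g v) = π₂ g (U v) := by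
    intro g v
    have hclosed : IsClosed ((LinearMap.eqLocus
        (U.toLinearEquiv.toLinearMap ∘ₗ (π₁ g).toLinearEquiv.toLinearMap)
        ((π₂ g).toLinearEquiv.toLinearMap ∘ₗ U.toLinearEquiv.toLinearMap) : Submodule ℂ H) :
        Set H) :=
      isClosed_eq (U.continuous.comp (π₁ g).continuous) ((π₂ g).continuous.comp U.continuous)
    have hle := cyclicSubspace_le (π := π₁) (v := v₁) hclosed (fun k => by
      change U (π₁ g (π₁ k v₁)) = π₂ g (U (π₁ k v₁))
      rw [← map_mul_apply, hU, hU, map_mul_apply])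
    rw [h₁] at hle
    exact hle (Submodule.mem_top (x := v))
  exact ⟨U, fun g v => by rw [hcomm, U.apply_symm_apply]⟩

theorem cyclicSubspace_restrict (π : UnitaryRep G H) (v : H) :
    (π.restrict (π.cyclicSubspace v) (π.isInvariant_cyclicSubspace v)).cyclicSubspace
      ⟨v, π.mem_cyclicSubspace v⟩ = ⊤ := by
  set σ := π.restrict (π.cyclicSubspace v) (π.isInvariant_cyclicSubspace v)
  set C := σ.cyclicSubspace ⟨v, π.mem_cyclicSubspace v⟩
  have hclosed : IsClosed ((C.map (π.cyclicSubspace v).subtype : Submodule ℂ H) : Set H) := by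
    rw [Submodule.map_coe]
    exact (π.isClosed_cyclicSubspace v).isClosedEmbedding_subtypeVal.isClosedMap _
      (σ.isClosed_cyclicSubspace _)
  have hle := cyclicSubspace_le (π := π) (v := v) hclosed fun g =>
    ⟨_, σ.apply_mem_cyclicSubspace g ⟨v, π.mem_cyclicSubspace v⟩, rfl⟩
  rw [eq_top_iff]
  intro x _
  obtain ⟨y, hy, hyx⟩ := hle x.2
  rwa [← Subtype.ext (a1 := y) (a2 := x) hyx]

/-- The restriction to the whole space is the representation itself. -/
theorem equivalent_restrict_of_eq_top (π : UnitaryRep G H) {K : Submodule ℂ H}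
    (hK : π.IsInvariant K) (h : K = ⊤) : π.Equivalent (π.restrict K hK) := by
  subst h
  refine ⟨(LinearIsometryEquiv.ofTop H ⊤ rfl).symm, fun g v => Subtype.ext ?_⟩
  rfl

end General

end UnitaryRep

/-! ### Von Neumann's projection -/

namespace Heisenberg

variable {d : ℕ}

/-- The point `(x, ω, 0)` of the Heisenberg group. -/
def ofPhase (z : EuclideanSpace ℝ (Fin d) × EuclideanSpace ℝ (Fin d)) : Heisenberg d :=
  ⟨z.1, z.2, 0⟩

theorem continuous_ofPhase : Continuous (ofPhase (d := d)) :=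
  continuous_induced_rng.2 (by simp only [ofPhase, Function.comp_def]; fun_prop)

theorem ofPhase_zero : ofPhase (0 : EuclideanSpace ℝ (Fin d) × EuclideanSpace ℝ (Fin d)) = 1 := rfl

theorem ofPhase_neg (z : EuclideanSpace ℝ (Fin d) × EuclideanSpace ℝ (Fin d)) :
    ofPhase (-z) = (ofPhase z)⁻¹ := by
  ext1 <;> simp [ofPhase]

end Heisenberg

open Heisenberg

section Projection

variable {d : ℕ} {H : Type*} [NormedAddCommGroup H] [InnerProductSpace ℂ H]

/-- The centre acts by the character `τ ↦ e^{2 π i τ}`. -/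
def HasUnitCentralCharacter (π : UnitaryRep (Heisenberg d) H) : Prop :=
  ∀ h v, π h v = expTwoPiI h.τ • π (ofPhase (h.x, h.ω)) v

theorem integrable_smul_apply (π : UnitaryRep (Heisenberg d) H)
    {f : EuclideanSpace ℝ (Fin d) × EuclideanSpace ℝ (Fin d) → ℂ} (hf : Integrable f) (v : H) :
    Integrable fun z => f z • π (ofPhase z) v := by
  refine hf.smul_bdd (C := ‖v‖) ?_ (Filter.Eventually.of_forall fun z => ?_)
  · exact ((π.strongly_continuous v).comp continuous_ofPhase).aestronglyMeasurable
  · exact ((π _).norm_map v).le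

/-- Von Neumann's operator `v ↦ ∫ e^{-π (|x|² + |ω|²) / 2} π(x, ω, 0) v dx dω`. When the centre
acts by `e^{2 π i τ}` it is an orthogonal projection. -/
def gaussianProjection (π : UnitaryRep (Heisenberg d) H) : H →L[ℂ] H :=
  LinearMap.mkContinuous
    { toFun := fun v => ∫ z, phaseGaussian z • π (ofPhase z) v
      map_add' := fun u v => by
        simp only [map_add, smul_add]
        exact integral_add (integrable_smul_apply π integrable_phaseGaussian u)
          (integrable_smul_apply π integrable_phaseGaussian v)
      map_smul' := fun c v => by
        simp only [map_smul, RingHom.id_apply, smul_comm _ c]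
        exact integral_smul c _ }
    (∫ z : EuclideanSpace ℝ (Fin d) × EuclideanSpace ℝ (Fin d), ‖phaseGaussian z‖)
    (fun v => by
      refine (norm_integral_le_integral_norm _).trans_eq ?_
      simp only [norm_smul, LinearIsometryEquiv.norm_map]
      exact integral_mul_const _ _)

theorem gaussianProjection_apply (π : UnitaryRep (Heisenberg d) H) (v : H) :
    gaussianProjection π v = ∫ z, phaseGaussian z • π (ofPhase z) v := rfl

variable [CompleteSpace H]

theorem inner_gaussianProjection (π : UnitaryRep (Heisenberg d) H) (u v : H) :
    inner ℂ u (gaussianProjection π v) =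
      ∫ z, phaseGaussian z * inner ℂ u (π (ofPhase z) v) := by
  rw [gaussianProjection_apply,
    ← integral_inner (integrable_smul_apply π integrable_phaseGaussian v)]
  simp only [inner_smul_right]

theorem inner_gaussianProjection_left (π : UnitaryRep (Heisenberg d) H) (u v : H) :
    inner ℂ (gaussianProjection π u) v = inner ℂ u (gaussianProjection π v) := by
  have := isAddHaarMeasure_volume_prod (V := EuclideanSpace ℝ (Fin d))
  have : (volume : Measure
      (EuclideanSpace ℝ (Fin d) × EuclideanSpace ℝ (Fin d))).IsNegInvariant :=
    Measure.IsAddHaarMeasure.isNegInvariant_of_regular _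
  rw [← inner_conj_symm, inner_gaussianProjection, inner_gaussianProjection, ← integral_conj,
    ← integral_neg_eq_self]
  refine integral_congr_ae (Filter.Eventually.of_forall fun z => ?_)
  simp only [map_mul, inner_conj_symm, phaseGaussian_neg, conj_phaseGaussian, ofPhase_neg,
    UnitaryRep.inner_map_left, inv_inv]

/-- The sandwich identity `P π(h) P = c(h) P` for von Neumann's projection. -/
theorem gaussianProjection_map_gaussianProjection {π : UnitaryRep (Heisenberg d) H}
    (hπ : HasUnitCentralCharacter π) (h : Heisenberg d) (v : H) :
    gaussianProjection π (π h (gaussianProjection π v)) =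
      (expTwoPiI h.τ * phaseGaussian (h.x, h.ω)) • gaussianProjection π v := by
  have := isAddHaarMeasure_volume_prod (V := EuclideanSpace ℝ (Fin d))
  rw [hπ, map_smul, mul_smul]
  congr 1
  set w : EuclideanSpace ℝ (Fin d) × EuclideanSpace ℝ (Fin d) := (h.x, h.ω) with hw
  -- the kernel obtained from the group law after substituting `u = z + w + z'`
  let F : EuclideanSpace ℝ (Fin d) × EuclideanSpace ℝ (Fin d) →
      EuclideanSpace ℝ (Fin d) × EuclideanSpace ℝ (Fin d) → ℂ := fun z u =>
    phaseGaussian z * phaseGaussian (u - z - w) *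
        expTwoPiI ((1 / 2 : ℝ) * (inner ℝ (w.1 + u.1) z.2 - inner ℝ (w.2 + u.2) z.1 +
          inner ℝ u.1 w.2 - inner ℝ w.1 u.2))
  have hstep : ∀ z, phaseGaussian z • π (ofPhase z) (π (ofPhase w) (gaussianProjection π v)) =
      ∫ u, F z u • π (ofPhase u) v := by
    intro z
    rw [gaussianProjection_apply, ← UnitaryRep.map_mul_apply]
    have hcomm := ((π (ofPhase z * ofPhase w)).toContinuousLinearEquiv :
      H →L[ℂ] H).integral_comp_comm (integrable_smul_apply π integrable_phaseGaussian v)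
    change ∫ z', π (ofPhase z * ofPhase w) (phaseGaussian z' • π (ofPhase z') v) =
      π (ofPhase z * ofPhase w) (∫ z', phaseGaussian z' • π (ofPhase z') v) at hcomm
    rw [← hcomm, ← integral_smul, ← integral_sub_right_eq_self _ (z + w)]
    refine integral_congr_ae (Filter.Eventually.of_forall fun u => ?_)
    simp only [map_smul]
    rw [← UnitaryRep.map_mul_apply, hπ, smul_smul, smul_smul, ← sub_sub]
    have hphase : (ofPhase z * ofPhase w * ofPhase (u - z - w)).τ =
        (1 / 2 : ℝ) * (inner ℝ (w.1 + u.1) z.2 - inner ℝ (w.2 + u.2) z.1 +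
          inner ℝ u.1 w.2 - inner ℝ w.1 u.2) := by
      simp only [ofPhase, mul_τ, mul_x, mul_ω, Prod.fst_sub, Prod.snd_sub, inner_add_left,
        inner_add_right, inner_sub_left, inner_sub_right, real_inner_comm z.1 w.2,
        real_inner_comm z.1 u.2]
      ring
    have hpoint : ((ofPhase z * ofPhase w * ofPhase (u - z - w)).x,
        (ofPhase z * ofPhase w * ofPhase (u - z - w)).ω) = u := by
      ext1
      · simp [ofPhase]
      · simp [ofPhase]
    rw [hphase, hpoint]
  rw [gaussianProjection_apply π (π (ofPhase w) _), integral_congr_ae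
    (Filter.Eventually.of_forall hstep)]
  have hFint : Integrable (Function.uncurry fun u z => F z u • π (ofPhase u) v)
      ((volume : Measure (EuclideanSpace ℝ (Fin d) × EuclideanSpace ℝ (Fin d))).prod volume) := by
    have h1 := Integrable.convolution_integrand (ContinuousLinearMap.mul ℂ ℂ)
      (integrable_phaseGaussian (V := EuclideanSpace ℝ (Fin d)))
      ((integrable_phaseGaussian (V := EuclideanSpace ℝ (Fin d))).comp_sub_right w)
    have h2 : Continuous fun p : (EuclideanSpace ℝ (Fin d) × EuclideanSpace ℝ (Fin d)) ×
        (EuclideanSpace ℝ (Fin d) × EuclideanSpace ℝ (Fin d)) =>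
        expTwoPiI ((1 / 2 : ℝ) * (inner ℝ (w.1 + p.1.1) p.2.2 - inner ℝ (w.2 + p.1.2) p.2.1 +
          inner ℝ p.1.1 w.2 - inner ℝ w.1 p.1.2)) • π (ofPhase p.1) v :=
      (continuous_expTwoPiI.comp (by fun_prop)).smul
        ((π.strongly_continuous v).comp (continuous_ofPhase.comp continuous_fst))
    refine (h1.smul_bdd (C := ‖v‖) h2.aestronglyMeasurable
      (Filter.Eventually.of_forall fun p => ?_)).congr (Filter.Eventually.of_forall fun p => ?_)
    · rw [norm_smul, norm_expTwoPiI, one_mul, LinearIsometryEquiv.norm_map]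
    · simp only [Function.uncurry, F, Pi.smul_apply', smul_smul, ContinuousLinearMap.mul_apply']
  rw [← integral_integral_swap hFint, gaussianProjection_apply, ← integral_smul]
  refine integral_congr_ae (Filter.Eventually.of_forall fun u => ?_)
  simp only
  rw [integral_smul_const, smul_smul]
  congr 1
  exact integral_phaseGaussian_mul_phaseGaussian w u

theorem gaussianProjection_gaussianProjection {π : UnitaryRep (Heisenberg d) H}
    (hπ : HasUnitCentralCharacter π) (v : H) :
    gaussianProjection π (gaussianProjection π v) = gaussianProjection π v := by
  have := gaussianProjection_map_gaussianProjection hπ 1 v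
  rw [UnitaryRep.map_one_apply] at this
  simpa [phaseGaussian] using this

/-- The matrix coefficients of vectors fixed by the projection are universal. -/
theorem inner_map_of_gaussianProjection_eq {π : UnitaryRep (Heisenberg d) H}
    (hπ : HasUnitCentralCharacter π) {u v : H} (hu : gaussianProjection π u = u)
    (hv : gaussianProjection π v = v) (h : Heisenberg d) :
    inner ℂ u (π h v) = (expTwoPiI h.τ * phaseGaussian (h.x, h.ω)) * inner ℂ u v := by
  rw [← hu, ← hv, inner_gaussianProjection_left, gaussianProjection_map_gaussianProjection hπ,
    inner_smul_right, hu, hv]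

/-- The symplectic form on phase space. -/
def symplecticForm (d : ℕ) : EuclideanSpace ℝ (Fin d) × EuclideanSpace ℝ (Fin d) →ₗ[ℝ]
    EuclideanSpace ℝ (Fin d) × EuclideanSpace ℝ (Fin d) →ₗ[ℝ] ℝ :=
  LinearMap.mk₂ ℝ (fun z w => inner ℝ z.2 w.1 - inner ℝ z.1 w.2)
    (fun z z' w => by simp only [Prod.fst_add, Prod.snd_add, inner_add_left]; ring)
    (fun c z w => by
      simp only [Prod.smul_fst, Prod.smul_snd, real_inner_smul_left, smul_eq_mul]; ring)
    (fun z w w' => by simp only [Prod.fst_add, Prod.snd_add, inner_add_right]; ring)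
    (fun c z w => by
      simp only [Prod.smul_fst, Prod.smul_snd, real_inner_smul_right, smul_eq_mul]; ring)

theorem symplecticForm_apply (z w : EuclideanSpace ℝ (Fin d) × EuclideanSpace ℝ (Fin d)) :
    symplecticForm d z w = inner ℝ z.2 w.1 - inner ℝ z.1 w.2 := rfl

theorem symplecticForm_ne_zero {z : EuclideanSpace ℝ (Fin d) × EuclideanSpace ℝ (Fin d)}
    (hz : z ≠ 0) : symplecticForm d z ≠ 0 := by
  intro h
  have h1 := DFunLike.congr_fun h (z.2, -z.1)
  rw [symplecticForm_apply] at h1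
  simp only [inner_neg_right, sub_neg_eq_add, real_inner_self_eq_norm_sq,
    LinearMap.zero_apply] at h1
  apply hz
  ext1
  · exact norm_eq_zero.1 (by nlinarith [sq_nonneg ‖z.1‖, sq_nonneg ‖z.2‖])
  · exact norm_eq_zero.1 (by nlinarith [sq_nonneg ‖z.1‖, sq_nonneg ‖z.2‖])

/-- Only the zero vector has an orbit killed by the projection: conjugating the projection by
`π(w)` multiplies its integrand by the character `e^{2 π i [z, w]}`, so that `z ↦ φ(z) ⟪v, π(z) v⟫`
has zero Fourier transform. -/
theorem eq_zero_of_forall_gaussianProjection_map_eq_zero {π : UnitaryRep (Heisenberg d) H}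
    (hπ : HasUnitCentralCharacter π) {v : H}
    (hv : ∀ h, gaussianProjection π (π h v) = 0) : v = 0 := by
  have := isAddHaarMeasure_volume_prod (V := EuclideanSpace ℝ (Fin d))
  have hcont : Continuous fun z => inner ℂ v (π (ofPhase z) v) :=
    continuous_const.inner ((π.strongly_continuous v).comp continuous_ofPhase)
  have hae : (fun z => phaseGaussian z * inner ℂ v (π (ofPhase z) v)) =ᵐ[volume] 0 := by
    refine ae_eq_zero_of_forall_integral_expTwoPiI_mul_eq_zero (L := symplecticForm d)
      (fun z => symplecticForm_ne_zero)
      (by simp only [symplecticForm_apply]; fun_prop) ?_ fun w => ?_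
    · exact integrable_phaseGaussian.mul_bdd (c := ‖v‖ * ‖v‖) hcont.aestronglyMeasurable
        (Filter.Eventually.of_forall fun z => (norm_inner_le_norm _ _).trans_eq
          (by rw [LinearIsometryEquiv.norm_map]))
    · have h1 := inner_gaussianProjection π (π (ofPhase w) v) (π (ofPhase w) v)
      rw [hv, inner_zero_right] at h1
      rw [h1]
      refine integral_congr_ae (Filter.Eventually.of_forall fun z => ?_)
      simp only
      rw [← UnitaryRep.map_mul_apply, UnitaryRep.inner_map_map',
        hπ ((ofPhase w)⁻¹ * (ofPhase z * ofPhase w)), inner_smul_right]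
      have hphase : ((ofPhase w)⁻¹ * (ofPhase z * ofPhase w)).τ = symplecticForm d z w := by
        simp only [ofPhase, symplecticForm_apply, mul_τ, inv_τ, mul_x, mul_ω, inv_x, inv_ω,
          inner_add_left, inner_add_right, inner_neg_left, inner_neg_right,
          real_inner_comm z.2 w.1]
        ring
      have hpoint : (((ofPhase w)⁻¹ * (ofPhase z * ofPhase w)).x,
          ((ofPhase w)⁻¹ * (ofPhase z * ofPhase w)).ω) = z := by
        ext1
        · simp [ofPhase]
        · simp [ofPhase]
      rw [hphase, hpoint]
      ring
  have heq := (Continuous.ae_eq_iff_eq volume (continuous_phaseGaussian.mul hcont)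
    continuous_zero).1 hae
  have h0 := congrFun heq 0
  simp only [Pi.mul_apply, Pi.zero_apply, phaseGaussian_zero, one_mul, ofPhase_zero,
    UnitaryRep.map_one_apply] at h0
  exact inner_self_eq_zero.1 h0

theorem exists_norm_eq_one_gaussianProjection_eq [Nontrivial H] {π : UnitaryRep (Heisenberg d) H}
    (hπ : HasUnitCentralCharacter π) : ∃ v, gaussianProjection π v = v ∧ ‖v‖ = 1 := by
  obtain ⟨v, hv⟩ := exists_ne (0 : H)
  have : ∃ h, gaussianProjection π (π h v) ≠ 0 := by
    by_contra! hcon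
    exact hv (eq_zero_of_forall_gaussianProjection_map_eq_zero hπ hcon)
  obtain ⟨h, hh⟩ := this
  refine ⟨((‖gaussianProjection π (π h v)‖⁻¹ : ℝ) : ℂ) • gaussianProjection π (π h v), ?_, ?_⟩
  · rw [map_smul, gaussianProjection_gaussianProjection hπ]
  · rw [norm_smul]
    simp [hh]

end Projection

/-! ### Irreducible representations -/

namespace UnitaryRep

section Irreducible

variable {G : Type*} [Group G] [TopologicalSpace G]
variable {H : Type*} [NormedAddCommGroup H] [InnerProductSpace ℂ H]
variable {H' : Type*} [NormedAddCommGroup H'] [InnerProductSpace ℂ H']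

theorem IsIrreducible.cyclicSubspace_eq_top {π : UnitaryRep G H} (hπ : π.IsIrreducible) {v : H}
    (hv : v ≠ 0) : π.cyclicSubspace v = ⊤ := by
  refine (hπ.2 _ (π.isClosed_cyclicSubspace v) (π.isInvariant_cyclicSubspace v)).resolve_left ?_
  intro h
  exact hv ((Submodule.mem_bot ℂ).1 (h ▸ π.mem_cyclicSubspace v))

/-- A continuous operator that commutes with an irreducible representation is zero or
injective. -/
theorem IsIrreducible.eq_zero_or_ker_eq_bot {π : UnitaryRep G H} (hπ : π.IsIrreducible)
    {T : H →L[ℂ] H} (hT : ∀ g v, T (π g v) = π g (T v)) :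
    T = 0 ∨ ∀ v, T v = 0 → v = 0 := by
  rcases hπ.2 (LinearMap.ker T.toLinearMap) (T.isClosed_ker) (fun g v hv => by
    have hv' : T v = 0 := hv
    change T (π g v) = 0
    rw [hT, hv', map_zero]) with h | h
  · right
    intro v hv
    exact (Submodule.mem_bot ℂ).1 (h ▸ (show v ∈ LinearMap.ker T.toLinearMap from hv))
  · left
    ext v
    have : v ∈ LinearMap.ker T.toLinearMap := h ▸ Submodule.mem_top
    exact this

/-- Schur's lemma for the operators of a representation. If the spectrum of `π z` contained two
points, two continuous functions with product zero, each non-zero at one of the points, would give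
operators `A B = 0` in the commutant, neither of them zero. -/
theorem IsIrreducible.exists_eq_smul_of_commute [CompleteSpace H] {π : UnitaryRep G H}
    (hπ : π.IsIrreducible) {z : G} (hz : ∀ g v, π z (π g v) = π g (π z v)) :
    ∃ c : ℂ, ∀ v, π z v = c • v := by
  have := hπ.1
  set T : H →L[ℂ] H := ((π z).toContinuousLinearEquiv : H →L[ℂ] H)
  have hTapp : ∀ v, T v = π z v := fun v => rfl
  have hstar : star T = ((π z⁻¹).toContinuousLinearEquiv : H →L[ℂ] H) := by
    refine ContinuousLinearMap.ext fun v => ext_inner_left ℂ fun u => ?_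
    rw [ContinuousLinearMap.star_eq_adjoint, ContinuousLinearMap.adjoint_inner_right, hTapp,
      inner_map_left]
    rfl
  have hstarapp : ∀ v, star T v = π z⁻¹ v := fun v => by rw [hstar]; rfl
  have hnormal : IsStarNormal T := ⟨ContinuousLinearMap.ext fun v => by
    change star T (T v) = T (star T v)
    rw [hstarapp, hstarapp, hTapp, hTapp, ← map_mul_apply, ← map_mul_apply, inv_mul_cancel,
      mul_inv_cancel]⟩
  have hz' : ∀ g v, π z⁻¹ (π g v) = π g (π z⁻¹ v) := by
    intro g v
    apply (π z).injective
    rw [hz g, ← map_mul_apply π z z⁻¹, ← map_mul_apply π z z⁻¹, mul_inv_cancel, map_one_apply,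
      map_one_apply]
  have hcomm : ∀ f : ℂ → ℂ, ∀ g v, cfc f T (π g v) = π g (cfc f T v) := by
    intro f g v
    have h1 : Commute T ((π g).toContinuousLinearEquiv : H →L[ℂ] H) :=
      ContinuousLinearMap.ext fun v => hz g v
    have h2 : Commute (star T) ((π g).toContinuousLinearEquiv : H →L[ℂ] H) := by
      rw [hstar]
      exact ContinuousLinearMap.ext fun v => hz' g v
    exact DFunLike.congr_fun (h1.cfc h2 f).eq v
  -- a bump function around `a` and the operator it gives
  let bump : ℝ → ℂ → ℂ → ℂ := fun r a w => ((max 0 (r - ‖w - a‖) : ℝ) : ℂ)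
  have hbump : ∀ r a, Continuous (bump r a) := fun r a => by
    simp only [bump]
    fun_prop
  have hne : ∀ r a, 0 < r → a ∈ spectrum ℂ T → cfc (bump r a) T ≠ 0 := by
    intro r a hr ha h0
    have h1 := cfc_map_spectrum (bump r a) T hnormal (hbump r a).continuousOn
    rw [h0, spectrum.zero_eq] at h1
    have h2 : bump r a a ∈ ({0} : Set ℂ) := h1 ▸ Set.mem_image_of_mem _ ha
    simp [bump] at h2
    linarith
  obtain ⟨c, hc⟩ := spectrum.nonempty T
  refine ⟨c, ?_⟩
  have hspec : ∀ a ∈ spectrum ℂ T, a = c := by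
    intro a ha
    by_contra hac
    have hr : 0 < ‖a - c‖ / 2 := half_pos (norm_pos_iff.2 (sub_ne_zero.2 hac))
    have hmul : cfc (bump (‖a - c‖ / 2) a) T * cfc (bump (‖a - c‖ / 2) c) T = 0 := by
      rw [← cfc_mul _ _ T (hbump _ _).continuousOn (hbump _ _).continuousOn]
      have : (fun w => bump (‖a - c‖ / 2) a w * bump (‖a - c‖ / 2) c w) = fun _ => 0 := by
        ext w
        have htri : ‖a - c‖ ≤ ‖w - a‖ + ‖w - c‖ := by
          rw [norm_sub_rev w a]
          simpa using norm_add_le (a - w) (w - c)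
        simp only [bump, ← Complex.ofReal_mul, Complex.ofReal_eq_zero, mul_eq_zero, max_eq_left_iff]
        by_contra! hcon
        linarith [hcon.1, hcon.2]
      rw [this, cfc_const_zero]
    rcases hπ.eq_zero_or_ker_eq_bot (hcomm (bump (‖a - c‖ / 2) a)) with h | h
    · exact hne _ _ hr ha h
    · refine hne _ _ hr hc (ContinuousLinearMap.ext fun v => h _ ?_)
      exact DFunLike.congr_fun hmul v
  have hT : T = algebraMap ℂ (H →L[ℂ] H) c := by
    rw [← cfc_const c T hnormal, ← cfc_congr (f := (id : ℂ → ℂ)) (a := T) hspec,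
      cfc_id ℂ T hnormal]
  intro v
  rw [← hTapp, hT]
  rfl

end Irreducible

end UnitaryRep

/-! ### The Schrödinger representation is irreducible -/

section Schrodinger

variable {d : ℕ}

theorem schrodinger_apply (h : Heisenberg d) (f : L2Space d) :
    schrodinger d h f = schrodingerOp h f := rfl

theorem schrodinger_central (τ : ℝ) (f : L2Space d) :
    schrodinger d ⟨0, 0, τ⟩ f = expTwoPiI τ • f := by
  rw [schrodinger_apply]
  refine Lp.ext ?_
  filter_upwards [schrodingerOp_coeFn ⟨0, 0, τ⟩ f, Lp.coeFn_smul (expTwoPiI τ) f] with t h1 h2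
  rw [h1, h2]
  simp

theorem Heisenberg.eq_central_mul_ofPhase (h : Heisenberg d) :
    h = ⟨0, 0, h.τ⟩ * ofPhase (h.x, h.ω) := by
  ext1 <;> simp [ofPhase]

theorem hasUnitCentralCharacter_of_central {H : Type*} [NormedAddCommGroup H]
    [InnerProductSpace ℂ H] {π : UnitaryRep (Heisenberg d) H}
    (h : ∀ (τ : ℝ) (v : H), π ⟨0, 0, τ⟩ v = expTwoPiI τ • v) : HasUnitCentralCharacter π := by
  intro k v
  conv_lhs => rw [k.eq_central_mul_ofPhase, UnitaryRep.map_mul_apply, h]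

theorem hasUnitCentralCharacter_schrodinger : HasUnitCentralCharacter (schrodinger d) :=
  hasUnitCentralCharacter_of_central schrodinger_central

instance : Nontrivial (L2Space d) := by
  have hfin : volume (Metric.ball (0 : EuclideanSpace ℝ (Fin d)) 1) ≠ ⊤ :=
    measure_ball_lt_top.ne
  refine ⟨⟨indicatorConstLp 2 Metric.isOpen_ball.measurableSet hfin (1 : ℂ), 0, ?_⟩⟩
  rw [← norm_ne_zero_iff, norm_indicatorConstLp (by simp) (by simp), norm_one, one_mul]
  refine (Real.rpow_pos_of_pos ?_ _).ne'
  exact ENNReal.toReal_pos (Metric.measure_ball_pos _ _ one_pos).ne' hfin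

/-- If `g` is orthogonal to all time-frequency shifts of `f`, then for every `x` the function
`t ↦ f (t - x) g(t)` vanishes almost everywhere. -/
theorem ae_mul_eq_zero_of_inner_schrodinger_eq_zero {f g : L2Space d}
    (h : ∀ k, inner ℂ g (schrodinger d k f) = 0) (x : EuclideanSpace ℝ (Fin d)) :
    ∀ᵐ t ∂volume, f (t - x) * starRingEnd ℂ (g t) = 0 := by
  refine ae_eq_zero_of_forall_integral_expTwoPiI_mul_eq_zero
    (L := innerₗ (EuclideanSpace ℝ (Fin d))) (μ := volume) (fun v hv h0 => ?_) (by simp only [innerₗ_apply_apply]; fun_prop) ?_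
    fun ω => ?_
  · exact hv ((inner_self_eq_zero (𝕜 := ℝ)).1 (DFunLike.congr_fun h0 v))
  · refine (L2.integrable_inner (𝕜 := ℂ) g (translation x f)).congr ?_
    filter_upwards [translation_coeFn x f] with t ht
    rw [ht]
    rfl
  · have h1 := h ⟨x, ω, (1 / 2 : ℝ) * inner ℝ x ω⟩
    rw [schrodinger_apply, L2.inner_def] at h1
    rw [← h1]
    refine integral_congr_ae ?_
    filter_upwards [schrodingerOp_coeFn ⟨x, ω, (1 / 2 : ℝ) * inner ℝ x ω⟩ f] with t ht
    rw [ht]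
    simp only [innerₗ_apply_apply, add_sub_cancel_left, RCLike.inner_apply]
    rw [real_inner_comm t ω]
    ring

/-- By Tonelli's theorem `∫∫ |f(t - x) g(t)| dt dx = ‖f‖₁ ‖g‖₁`, so that two functions all of
whose shifted products vanish cannot both be non-zero. -/
theorem eq_zero_or_eq_zero_of_inner_schrodinger_eq_zero {f g : L2Space d}
    (h : ∀ k, inner ℂ g (schrodinger d k f) = 0) : f = 0 ∨ g = 0 := by
  have hf : Measurable f := (Lp.stronglyMeasurable f).measurable
  have hg : Measurable g := (Lp.stronglyMeasurable g).measurable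
  have hzero : ∫⁻ x, ∫⁻ t, ‖f (t - x)‖ₑ * ‖g t‖ₑ = 0 := by
    have : ∀ x, ∫⁻ t, ‖f (t - x)‖ₑ * ‖g t‖ₑ = 0 := by
      intro x
      rw [lintegral_eq_zero_iff (by fun_prop)]
      filter_upwards [ae_mul_eq_zero_of_inner_schrodinger_eq_zero h x] with t ht
      simpa using ht
    simp [this]
  rw [lintegral_lintegral_swap (by fun_prop)] at hzero
  have hinner : ∀ t, ∫⁻ x, ‖f (t - x)‖ₑ * ‖g t‖ₑ = (∫⁻ x, ‖f x‖ₑ) * ‖g t‖ₑ := by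
    intro t
    rw [lintegral_mul_const _ (by fun_prop), lintegral_sub_left_eq_self (fun x => ‖f x‖ₑ) t]
  simp only [hinner] at hzero
  rw [lintegral_const_mul _ (by fun_prop), mul_eq_zero] at hzero
  refine hzero.imp (fun h0 => ?_) (fun h0 => ?_)
  all_goals
    rw [lintegral_eq_zero_iff (by fun_prop)] at h0
    refine Lp.ext ?_
    filter_upwards [h0, Lp.coeFn_zero ℂ 2 (volume : Measure (EuclideanSpace ℝ (Fin d)))]
      with t ht h2
    rw [h2]
    simpa using ht

theorem isIrreducible_schrodinger : (schrodinger d).IsIrreducible := by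
  refine ⟨inferInstance, fun K hK hinv => ?_⟩
  rw [or_iff_not_imp_left]
  intro hbot
  obtain ⟨f, hf, hf0⟩ := K.exists_mem_ne_zero_of_ne_bot hbot
  have : CompleteSpace K := hK.completeSpace_coe
  rw [← Submodule.orthogonal_eq_bot_iff, Submodule.eq_bot_iff]
  intro g hg
  refine (eq_zero_or_eq_zero_of_inner_schrodinger_eq_zero fun k => ?_).resolve_left hf0
  exact Submodule.inner_left_of_mem_orthogonal (hinv k f hf) hg

end Schrodinger

/-! ### Representations with central character `e^{2πiτ}` -/

section Decomposition

variable {d : ℕ} {H : Type*} [NormedAddCommGroup H] [InnerProductSpace ℂ H] [CompleteSpace H]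

theorem inner_self_map_of_gaussianProjection_eq {π : UnitaryRep (Heisenberg d) H}
    (hπ : HasUnitCentralCharacter π) {v : H} (hv : gaussianProjection π v = v) (h1 : ‖v‖ = 1)
    (h : Heisenberg d) :
    inner ℂ v (π h v) = expTwoPiI h.τ * phaseGaussian (h.x, h.ω) := by
  rw [inner_map_of_gaussianProjection_eq hπ hv hv, inner_self_eq_norm_sq_to_K, h1]
  simp

theorem restrict_cyclicSubspace_equivalent_schrodinger {π : UnitaryRep (Heisenberg d) H}
    (hπ : HasUnitCentralCharacter π) {v : H} (hv : gaussianProjection π v = v) (h1 : ‖v‖ = 1) :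
    (π.restrict (π.cyclicSubspace v) (π.isInvariant_cyclicSubspace v)).Equivalent
      (schrodinger d) := by
  obtain ⟨g, hg, hg1⟩ :=
    exists_norm_eq_one_gaussianProjection_eq (hasUnitCentralCharacter_schrodinger (d := d))
  have : CompleteSpace (π.cyclicSubspace v) := (π.isClosed_cyclicSubspace v).completeSpace_coe
  refine UnitaryRep.equivalent_of_inner_eq (π.cyclicSubspace_restrict v)
    (isIrreducible_schrodinger.cyclicSubspace_eq_top (v := g) ?_) fun h => ?_
  · rintro rfl
    simp at hg1
  · rw [inner_self_map_of_gaussianProjection_eq hasUnitCentralCharacter_schrodinger hg hg1,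
      ← inner_self_map_of_gaussianProjection_eq hπ hv h1]
    rfl

/-- The orbits of an orthonormal basis of the range of von Neumann's projection span the
summands. -/
theorem exists_isHilbertSum_equivalent_schrodinger {π : UnitaryRep (Heisenberg d) H}
    (hπ : HasUnitCentralCharacter π) :
    ∃ (J : Set (Submodule ℂ H)) (hJ : ∀ K ∈ J, π.IsInvariant K),
      (∀ K ∈ J, IsClosed (K : Set H)) ∧
      IsHilbertSum ℂ (fun K : J => (K : Submodule ℂ H))
        (fun K : J => (K : Submodule ℂ H).subtypeₗᵢ) ∧
      ∀ K : J, (π.restrict K (hJ K K.2)).Equivalent (schrodinger d) := by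
  let F : Submodule ℂ H :=
    LinearMap.eqLocus (gaussianProjection π).toLinearMap LinearMap.id
  have hF : ∀ v, v ∈ F ↔ gaussianProjection π v = v := fun v => Iff.rfl
  have hFclosed : IsClosed (F : Set H) :=
    isClosed_eq (gaussianProjection π).continuous continuous_id
  have : CompleteSpace F := hFclosed.completeSpace_coe
  obtain ⟨s, b, -⟩ := exists_hilbertBasis ℂ F
  have hb : ∀ i, gaussianProjection π (b i : H) = b i := fun i => (hF _).1 (b i).2
  have hb1 : ∀ i, ‖(b i : H)‖ = 1 := fun i => b.orthonormal.1 i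
  let J : Set (Submodule ℂ H) := Set.range fun i => π.cyclicSubspace (b i : H)
  have hinv : ∀ K ∈ J, π.IsInvariant K := by
    rintro _ ⟨i, rfl⟩
    exact π.isInvariant_cyclicSubspace _
  have hclosed : ∀ K ∈ J, IsClosed (K : Set H) := by
    rintro _ ⟨i, rfl⟩
    exact π.isClosed_cyclicSubspace _
  refine ⟨J, hinv, hclosed, ?_, ?_⟩
  · have : ∀ K : J, CompleteSpace (K : Submodule ℂ H) := fun K =>
      (hclosed K K.2).completeSpace_coe
    refine IsHilbertSum.mkInternal _ ?_ ?_
    · rintro ⟨_, i, rfl⟩ ⟨_, j, rfl⟩ hij x y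
      have hne : i ≠ j := by
        rintro rfl
        exact hij rfl
      refine UnitaryRep.inner_eq_zero_of_mem_cyclicSubspace (fun g => ?_) x.2 y.2
      have h0 : inner ℂ (b i : H) (b j : H) = 0 := b.orthonormal.2 hne
      rw [inner_map_of_gaussianProjection_eq hπ (hb i) (hb j), h0, mul_zero]
    · rw [top_le_iff, Submodule.topologicalClosure_eq_top_iff, Submodule.eq_bot_iff]
      intro v hv
      refine eq_zero_of_forall_gaussianProjection_map_eq_zero hπ fun h => ?_
      have hmem : gaussianProjection π (π h v) ∈ F :=
        gaussianProjection_gaussianProjection hπ _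
      have hzero : (⟨gaussianProjection π (π h v), hmem⟩ : F) = 0 := by
        apply b.repr.injective
        ext i
        rw [b.repr_apply_apply, map_zero]
        change inner ℂ (b i : H) (gaussianProjection π (π h v)) = 0
        rw [← inner_gaussianProjection_left, hb, ← inv_inv h, ← UnitaryRep.inner_map_left]
        exact Submodule.inner_right_of_mem_orthogonal
          (Submodule.mem_iSup_of_mem (p := fun K : J => (K : Submodule ℂ H)) ⟨_, i, rfl⟩
            (π.apply_mem_cyclicSubspace _ _)) hv
      exact congrArg Subtype.val hzero
  · rintro ⟨_, i, rfl⟩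
    exact restrict_cyclicSubspace_equivalent_schrodinger hπ (hb i) (hb1 i)

theorem equivalent_schrodinger_of_isIrreducible {π : UnitaryRep (Heisenberg d) H}
    (hirr : π.IsIrreducible) (hπ : HasUnitCentralCharacter π) :
    π.Equivalent (schrodinger d) := by
  have := hirr.1
  obtain ⟨v, hv, hv1⟩ := exists_norm_eq_one_gaussianProjection_eq hπ
  have hv0 : v ≠ 0 := by
    rintro rfl
    simp at hv1
  exact (π.equivalent_restrict_of_eq_top _ (hirr.cyclicSubspace_eq_top hv0)).trans
    (restrict_cyclicSubspace_equivalent_schrodinger hπ hv hv1)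

end Decomposition

/-! ### The classification of irreducible representations -/

section Classification

variable {d : ℕ}

theorem UnitaryRep.Equivalent.eq_of_eq_smul {G : Type*} [Group G] [TopologicalSpace G]
    {H H' : Type*} [NormedAddCommGroup H] [InnerProductSpace ℂ H] [NormedAddCommGroup H']
    [InnerProductSpace ℂ H'] [Nontrivial H'] {π₁ : UnitaryRep G H} {π₂ : UnitaryRep G H'}
    (h : π₁.Equivalent π₂) {g : G} {c₁ c₂ : ℂ} (h₁ : ∀ v, π₁ g v = c₁ • v)
    (h₂ : ∀ v, π₂ g v = c₂ • v) : c₁ = c₂ := by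
  obtain ⟨U, hU⟩ := h
  obtain ⟨v, hv⟩ := exists_ne (0 : H')
  have := hU g v
  rw [h₁, h₂, map_smul, U.apply_symm_apply] at this
  exact smul_left_injective ℂ hv this

theorem heisenbergChar_apply (a b : EuclideanSpace ℝ (Fin d)) (h : Heisenberg d) (v : ℂ) :
    heisenbergChar a b h v = expTwoPiI (inner ℝ a h.x + inner ℝ b h.ω) • v := rfl

theorem schrodingerRep_central (κ τ : ℝ) (f : L2Space d) :
    schrodingerRep d κ ⟨0, 0, τ⟩ f = expTwoPiI (κ * τ) • f := by
  rw [← schrodinger_central]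
  change schrodinger d (dilation κ ⟨0, 0, τ⟩) f = _
  congr 2
  ext1 <;> simp [dilation]

theorem heisenbergChar_central (a b : EuclideanSpace ℝ (Fin d)) (τ : ℝ) (v : ℂ) :
    heisenbergChar a b ⟨0, 0, τ⟩ v = expTwoPiI (0 * τ) • v := by
  simp [heisenbergChar_apply]

theorem eq_of_forall_expTwoPiI_mul_eq {s t : ℝ}
    (h : ∀ τ, expTwoPiI (s * τ) = expTwoPiI (t * τ)) : s = t := by
  rw [← sub_eq_zero]
  refine eq_zero_of_forall_expTwoPiI_mul_eq_one fun τ => ?_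
  rw [sub_mul, sub_eq_add_neg, expTwoPiI_add, h, ← expTwoPiI_add, add_neg_cancel, expTwoPiI_zero]

theorem schrodingerRep_injective {κ κ' : ℝ}
    (h : (schrodingerRep d κ).Equivalent (schrodingerRep d κ')) : κ = κ' :=
  eq_of_forall_expTwoPiI_mul_eq fun τ =>
    h.eq_of_eq_smul (schrodingerRep_central κ τ) (schrodingerRep_central κ' τ)

theorem not_schrodingerRep_equivalent_heisenbergChar {κ : ℝ} (hκ : κ ≠ 0)
    (a b : EuclideanSpace ℝ (Fin d)) :
    ¬ (schrodingerRep d κ).Equivalent (heisenbergChar a b) := fun h =>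
  hκ (eq_of_forall_expTwoPiI_mul_eq fun τ =>
    h.eq_of_eq_smul (schrodingerRep_central κ τ) (heisenbergChar_central a b τ))

theorem heisenbergChar_injective {a b a' b' : EuclideanSpace ℝ (Fin d)}
    (h : (heisenbergChar a b).Equivalent (heisenbergChar a' b')) : (a, b) = (a', b') := by
  have key : ∀ k : Heisenberg d, expTwoPiI (inner ℝ a k.x + inner ℝ b k.ω) =
      expTwoPiI (inner ℝ a' k.x + inner ℝ b' k.ω) := fun k =>
    h.eq_of_eq_smul (heisenbergChar_apply a b k) (heisenbergChar_apply a' b' k)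
  ext1
  · refine ext_inner_right ℝ fun v => eq_of_forall_expTwoPiI_mul_eq fun t => ?_
    simpa [real_inner_smul_right, mul_comm] using key ⟨t • v, 0, 0⟩
  · refine ext_inner_right ℝ fun v => eq_of_forall_expTwoPiI_mul_eq fun t => ?_
    simpa [real_inner_smul_right, mul_comm] using key ⟨0, t • v, 0⟩

theorem exists_eq_expTwoPiI_inner {c : EuclideanSpace ℝ (Fin d) → ℂ} (hc : Continuous c)
    (hnorm : ∀ x, ‖c x‖ = 1) (hadd : ∀ x y, c (x + y) = c x * c y) :
    ∃ a, ∀ x, c x = expTwoPiI (inner ℝ a x) := by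
  have h0 : c 0 = 1 := by
    have h1 := hadd 0 0
    have h2 : c 0 ≠ 0 := by
      intro h
      simpa [h] using hnorm 0
    rw [add_zero] at h1
    exact (mul_eq_left₀ h2).1 h1.symm
  have hcoord : ∀ i, ∃ κ : ℝ, ∀ t : ℝ,
      c (t • EuclideanSpace.single i 1) = expTwoPiI (κ * t) := fun i =>
    exists_eq_expTwoPiI_of_continuous (by fun_prop) (fun t => hnorm _)
      (fun s t => by rw [add_smul, hadd])
  choose κ hκ using hcoord
  refine ⟨WithLp.toLp 2 κ, fun x => ?_⟩
  have hsum : ∀ s : Finset (Fin d), c (∑ i ∈ s, x i • EuclideanSpace.single i (1 : ℝ)) =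
      expTwoPiI (∑ i ∈ s, κ i * x i) := by
    intro s
    induction s using Finset.induction_on with
    | empty => simp [h0]
    | insert i s hi ih =>
      rw [Finset.sum_insert hi, Finset.sum_insert hi, hadd, expTwoPiI_add, hκ, ih]
  have hx : ∑ i, x i • EuclideanSpace.single i (1 : ℝ) = x := by
    simpa using (EuclideanSpace.basisFun (Fin d) ℝ).sum_repr x
  rw [← hx, hsum, hx]
  simp [PiLp.inner_apply, mul_comm]

variable {H : Type*} [NormedAddCommGroup H] [InnerProductSpace ℂ H]

theorem norm_eq_one_of_map_eq_smul [Nontrivial H] {π : UnitaryRep (Heisenberg d) H}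
    {h : Heisenberg d} {c : ℂ} (hc : ∀ v, π h v = c • v) : ‖c‖ = 1 := by
  obtain ⟨v, hv⟩ := exists_ne (0 : H)
  have h1 := (π h).norm_map v
  rw [hc, norm_smul] at h1
  exact (mul_eq_right₀ (norm_ne_zero_iff.2 hv)).1 h1

theorem exists_central_character [CompleteSpace H] {π : UnitaryRep (Heisenberg d) H}
    (hπ : π.IsIrreducible) :
    ∃ κ : ℝ, ∀ τ v, π ⟨0, 0, τ⟩ v = expTwoPiI (κ * τ) • v := by
  have := hπ.1
  have hcentral : ∀ τ : ℝ, ∃ c : ℂ, ∀ v, π ⟨0, 0, τ⟩ v = c • v := fun τ =>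
    hπ.exists_eq_smul_of_commute fun g v => by
      rw [← UnitaryRep.map_mul_apply, ← UnitaryRep.map_mul_apply]
      congr 2
      ext1 <;> simp [add_comm]
  choose c hc using hcentral
  obtain ⟨u, hu⟩ := exists_ne (0 : H)
  have hcont : Continuous c := by
    have h1 : Continuous fun τ : ℝ => inner ℂ u (π ⟨0, 0, τ⟩ u) / inner ℂ u u :=
      (continuous_const.inner ((π.strongly_continuous u).comp
        (continuous_induced_rng.2 (by simp only [Function.comp_def]; fun_prop)))).div_const _
    refine h1.congr fun τ => ?_
    rw [hc, inner_smul_right, mul_div_cancel_right₀ _ (inner_self_ne_zero.2 hu)]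
  obtain ⟨κ, hκ⟩ := exists_eq_expTwoPiI_of_continuous hcont
    (fun τ => norm_eq_one_of_map_eq_smul (hc τ)) (fun s t => by
      have h1 : (⟨0, 0, s + t⟩ : Heisenberg d) = ⟨0, 0, s⟩ * ⟨0, 0, t⟩ := by ext1 <;> simp
      have h2 := hc (s + t) u
      rw [h1, UnitaryRep.map_mul_apply, hc, hc, smul_smul] at h2
      exact (smul_left_injective ℂ hu h2).symm)
  exact ⟨κ, fun τ v => by rw [hc, hκ]⟩

/-- When the centre acts trivially all operators commute, so by Schur's lemma they are scalars. -/
theorem exists_equivalent_heisenbergChar [CompleteSpace H] {π : UnitaryRep (Heisenberg d) H}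
    (hπ : π.IsIrreducible) (h0 : ∀ τ v, π ⟨0, 0, τ⟩ v = v) :
    ∃ a b, π.Equivalent (heisenbergChar a b) := by
  have := hπ.1
  have hphase : ∀ h v, π h v = π (ofPhase (h.x, h.ω)) v := fun h v => by
    conv_lhs => rw [h.eq_central_mul_ofPhase, UnitaryRep.map_mul_apply, h0]
  have hscalar : ∀ h : Heisenberg d, ∃ c : ℂ, ∀ v, π h v = c • v := fun h =>
    hπ.exists_eq_smul_of_commute fun g v => by
      rw [← UnitaryRep.map_mul_apply, ← UnitaryRep.map_mul_apply, hphase, hphase (g * h), mul_x,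
        mul_ω, mul_x, mul_ω, add_comm g.x, add_comm g.ω]
  choose c hc using hscalar
  obtain ⟨u, hu1⟩ : ∃ u : H, ‖u‖ = 1 := by
    obtain ⟨v, hv⟩ := exists_ne (0 : H)
    exact ⟨((‖v‖⁻¹ : ℝ) : ℂ) • v, by rw [norm_smul]; simp [hv]⟩
  have hu : u ≠ 0 := norm_ne_zero_iff.1 (hu1 ▸ one_ne_zero)
  have hcont : Continuous c := by
    have h1 : Continuous fun h => inner ℂ u (π h u) / inner ℂ u u :=
      (continuous_const.inner (π.strongly_continuous u)).div_const _
    refine h1.congr fun τ => ?_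
    rw [hc, inner_smul_right, mul_div_cancel_right₀ _ (inner_self_ne_zero.2 hu)]
  have hmul : ∀ h k, c (h * k) = c h * c k := fun h k => by
    have h2 := hc (h * k) u
    rw [UnitaryRep.map_mul_apply, hc k, map_smul, hc h, smul_smul, mul_comm] at h2
    exact (smul_left_injective ℂ hu h2).symm
  have hnorm : ∀ h, ‖c h‖ = 1 := fun h => norm_eq_one_of_map_eq_smul (hc h)
  obtain ⟨a, ha⟩ := exists_eq_expTwoPiI_inner (c := fun x => c ⟨x, 0, 0⟩)
    (hcont.comp (continuous_induced_rng.2 (by simp only [Function.comp_def]; fun_prop)))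
    (fun x => hnorm _) (fun x y => by rw [← hmul]; congr 1; ext1 <;> simp)
  obtain ⟨b, hb⟩ := exists_eq_expTwoPiI_inner (c := fun ω => c ⟨0, ω, 0⟩)
    (hcont.comp (continuous_induced_rng.2 (by simp only [Function.comp_def]; fun_prop)))
    (fun x => hnorm _) (fun x y => by rw [← hmul]; congr 1; ext1 <;> simp)
  have hval : ∀ h v, π h v = expTwoPiI (inner ℝ a h.x + inner ℝ b h.ω) • v := by
    intro h v
    have h1 : ofPhase (h.x, h.ω) = ofPhase ((⟨h.x, 0, 0⟩ * ⟨0, h.ω, 0⟩ : Heisenberg d).x,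
        (⟨h.x, 0, 0⟩ * ⟨0, h.ω, 0⟩ : Heisenberg d).ω) := by simp
    rw [hphase, h1, ← hphase, hc, hmul, expTwoPiI_add]
    congr 2
    · exact ha h.x
    · exact hb h.ω
  have hcyc : (heisenbergChar a b).cyclicSubspace 1 = ⊤ := by
    rw [eq_top_iff]
    intro x _
    simpa using Submodule.smul_mem _ x ((heisenbergChar a b).mem_cyclicSubspace 1)
  refine ⟨a, b, UnitaryRep.equivalent_of_inner_eq (hπ.cyclicSubspace_eq_top hu) hcyc fun h => ?_⟩
  rw [hval, heisenbergChar_apply, inner_smul_right, inner_smul_right, inner_self_eq_norm_sq_to_K,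
    inner_self_eq_norm_sq_to_K, hu1, norm_one]

/-- Rescaling by `δ_{1/κ}` reduces to the central character `e^{2 π i τ}`. -/
theorem equivalent_schrodingerRep [CompleteSpace H] {π : UnitaryRep (Heisenberg d) H}
    (hπ : π.IsIrreducible) {κ : ℝ} (hκ : κ ≠ 0)
    (hc : ∀ τ v, π ⟨0, 0, τ⟩ v = expTwoPiI (κ * τ) • v) :
    π.Equivalent (schrodingerRep d κ) := by
  have hdil : ∀ h : Heisenberg d, dilation κ⁻¹ (dilation κ h) = h := fun h => by
    ext1 <;> simp [dilation, hκ]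
  let σ : UnitaryRep (Heisenberg d) H := π.comp (dilation κ⁻¹) (continuous_dilation κ⁻¹)
  have hσ : ∀ h v, σ h v = π (dilation κ⁻¹ h) v := fun h v => rfl
  have hirr : σ.IsIrreducible := ⟨hπ.1, fun K hK hinv => hπ.2 K hK fun h v hv => by
    rw [← hdil h, ← hσ]
    exact hinv _ v hv⟩
  have hunit : HasUnitCentralCharacter σ := hasUnitCentralCharacter_of_central fun τ v => by
    have : dilation κ⁻¹ (⟨0, 0, τ⟩ : Heisenberg d) = ⟨0, 0, κ⁻¹ * τ⟩ := by
      ext1 <;> simp [dilation]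
    rw [hσ, this, hc, mul_inv_cancel_left₀ hκ]
  obtain ⟨U, hU⟩ := equivalent_schrodinger_of_isIrreducible hirr hunit
  refine ⟨U, fun h v => ?_⟩
  have := hU (dilation κ h) v
  rwa [hσ, hdil] at this

end Classification

end

theorem mainTheorem10 (d : ℕ) :
    -- every irreducible unitary representation is equivalent to exactly one representation of the
    -- list consisting of the characters and the representations `ρ_κ` with `κ ≠ 0`
    (∀ (H : Type*) [NormedAddCommGroup H] [InnerProductSpace ℂ H] [CompleteSpace H]
      (π : UnitaryRep (Heisenberg d) H), π.IsIrreducible →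
        ((∃! p : EuclideanSpace ℝ (Fin d) × EuclideanSpace ℝ (Fin d),
              π.Equivalent (heisenbergChar p.1 p.2)) ∧
            ¬ ∃ κ : ℝ, κ ≠ 0 ∧ π.Equivalent (schrodingerRep d κ)) ∨
          ((∃! κ : ℝ, κ ≠ 0 ∧ π.Equivalent (schrodingerRep d κ)) ∧
            ¬ ∃ a b : EuclideanSpace ℝ (Fin d), π.Equivalent (heisenbergChar a b))) ∧
    -- every unitary representation with central character `e^{2 π i τ}` is a Hilbert space direct
    -- sum of closed invariant subspaces on which it is equivalent to `ρ`
    (∀ (H : Type*) [NormedAddCommGroup H] [InnerProductSpace ℂ H] [CompleteSpace H]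
      (π : UnitaryRep (Heisenberg d) H),
        (∀ (x ω : EuclideanSpace ℝ (Fin d)) (τ : ℝ) (v : H),
          π ⟨x, ω, τ⟩ v = Complex.exp (2 * Real.pi * Complex.I * τ) • π ⟨x, ω, 0⟩ v) →
        ∃ (J : Set (Submodule ℂ H)) (hJ : ∀ K ∈ J, π.IsInvariant K),
          (∀ K ∈ J, IsClosed (K : Set H)) ∧
          IsHilbertSum ℂ (fun K : J => (K : Submodule ℂ H))
            (fun K : J => (K : Submodule ℂ H).subtypeₗᵢ) ∧
          ∀ K : J, (π.restrict K (hJ K K.2)).Equivalent (schrodinger d)) := by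

  refine ⟨fun H _ _ _ π hπ => ?_, fun H _ _ _ π hπ => ?_⟩
  · obtain ⟨κ, hκ⟩ := exists_central_character hπ
    by_cases h0 : κ = 0
    · left
      obtain ⟨a, b, hab⟩ := exists_equivalent_heisenbergChar hπ (fun τ v => by simp [hκ, h0])
      refine ⟨⟨(a, b), hab, fun p hp => ?_⟩, ?_⟩
      · exact heisenbergChar_injective (hp.symm.trans hab)
      · rintro ⟨κ', hκ', h⟩
        exact not_schrodingerRep_equivalent_heisenbergChar hκ' a b (h.symm.trans hab)
    · right
      have hequiv := equivalent_schrodingerRep hπ h0 hκ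
      refine ⟨⟨κ, ⟨h0, hequiv⟩, fun κ' h => ?_⟩, ?_⟩
      · exact schrodingerRep_injective (h.2.symm.trans hequiv)
      · rintro ⟨a, b, h⟩
        exact not_schrodingerRep_equivalent_heisenbergChar h0 a b (hequiv.symm.trans h)
  · exact exists_isHilbertSum_equivalent_schrodinger fun h v => hπ h.x h.ω h.τ v
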